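/- Let $G=(V,E)$ be a finite simple graph with maximum degree $\Delta\ge 2$ and without isolated edges (an isolated edge is an edge both of whose ends have degree $1$), and let $r\ge 2$ be an integer. Let $\chi'_{\Sigma,r}(G)$ be the least integer $k$ for which there is a proper edge colouring $c:E\to\{1,2,\ldots,k\}$ such that $\sum_{e\ni u}c(e)\neq\sum_{e\ni v}c(e)$ for all $u,v\in V$ with $1\le d(u,v)\le r$, where $d(u,v)$ is the distance of $u$ and $v$ in $G$ (infinite if they lie in different components). Let $M_{\Delta,r}=1+\Delta+\Delta(\Delta-1)+\cdots+\Delta(\Delta-1)^{r-1}$ be the Moore bound. Then such a $k$ exists, and $$\chi'_{\Sigma,r}(G)\le 6\left(\frac{M_{\Delta,r}-1}{\Delta}+\Delta-1\right)+\Delta.$$ Consequently $\chi'_{\Sigma,r}(G)\le 6\Delta^{r-1}$ if $r\ge 4$, while $\chi'_{\Sigma,3}(G)\le 6\Delta^2+\Delta$ and $\chi'_{\Sigma,2}(G)\le 13\Delta-6$. -/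

import Mathlib

namespace DistantSum

variable {V : Type*} [Fintype V] [DecidableEq V]

/-- The weighted degree of `v` (the sum at `v`): the sum of the colours of the edges incident
with `v`. Only the values of `c` on edges of `G` matter. -/
def weightedDegree (G : SimpleGraph V) [DecidableRel G.Adj] (c : Sym2 V → ℕ) (v : V) : ℕ :=
  ∑ e ∈ G.incidenceFinset v, c e

/-- `c`, restricted to the edges of `G`, is a proper edge colouring with colours in
`{1, …, k}`: distinct edges with a common end get distinct colours. -/
def IsProperEdgeColouring (G : SimpleGraph V) (k : ℕ) (c : Sym2 V → ℕ) : Prop :=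
  (∀ e ∈ G.edgeSet, 1 ≤ c e ∧ c e ≤ k) ∧
    ∀ e ∈ G.edgeSet, ∀ f ∈ G.edgeSet, e ≠ f → (∃ v, v ∈ e ∧ v ∈ f) → c e ≠ c f

/-- Any two distinct vertices at distance at most `r` have distinct sums. Vertices in different
components are at distance `⊤`. -/
def DistinguishesSums (G : SimpleGraph V) [DecidableRel G.Adj] (r : ℕ) (c : Sym2 V → ℕ) : Prop :=
  ∀ u v : V, u ≠ v → G.edist u v ≤ (r : ℕ∞) → weightedDegree G c u ≠ weightedDegree G c v

/-- The `r`-distant sum distinguishing index of `G`: the least `k` for which there is a proper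
edge colouring with colours in `{1, …, k}` that distinguishes by sums any two distinct vertices at
distance at most `r`; it is `⊤` if there is no such `k`. -/
noncomputable def sumIndex (G : SimpleGraph V) [DecidableRel G.Adj] (r : ℕ) : ℕ∞ :=
  ⨅ k ∈ {k : ℕ | ∃ c : Sym2 V → ℕ, IsProperEdgeColouring G k c ∧ DistinguishesSums G r c}, (k : ℕ∞)

/-- No edge of `G` is isolated, that is, no edge has two ends of degree one. -/
def NoIsolatedEdges (G : SimpleGraph V) [DecidableRel G.Adj] : Prop :=
  ∀ u v : V, G.Adj u v → ¬ (G.degree u = 1 ∧ G.degree v = 1)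

/-- The Moore bound `1 + Δ + Δ(Δ-1) + ⋯ + Δ(Δ-1)^(r-1)`. -/
def mooreBound (Δ r : ℕ) : ℕ :=
  1 + ∑ i ∈ Finset.range r, Δ * (Δ - 1) ^ i

end DistantSum

/-! Put S = 1 + (Δ-1) + ... + (Δ-1)^(r-1), which is (M-1)/Δ for the Moore bound M, and k = 2S + 2Δ -
2. Colours in {1, ..., 3k} suffice, and 3k = 6(S + Δ - 1), so the summand Δ in the bound is slack.

Components are coloured separately, greedily, one vertex at a time. The numbers are split into pairs
{a, a + k}, and each processed vertex is committed to the pair containing its sum; vertices within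
distance r get different pairs. An edge from a processed to an unprocessed vertex has its colour in
(k, 2k], so it can be shifted once by k, up or down, as its processed end requires, staying in [1,
3k]. Properness is kept modulo k, hence survives every shift. When v is processed, each earlier
neighbour may take either sum of its pair, which moves the sum of v by k, and the later edges at v
get fresh colours. This yields more sums (`exists_many_sums`) than the at most deg(v) * S other
vertices of the ball around v (`card_punctured_le`) can forbid, provided v has a later neighbour
(`IsPartialColouring.exists_insert`). Processing towards a vertex z provides one for every vertex
but the last two, u and z, where z has maximum degree in its component.

The edge uz gets a colour ρ + k * a with a ≤ 2. Averaging over ρ (`exists_small_counts`) finds a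
residue in which few sums obstruct u and z at once; shifts of the other edges at u and z then finish
the colouring (`IsAlmostColouring.exists_completion`). -/

namespace DistantSum
open Finset
set_option linter.unusedSectionVars false


/-! ### Pairs of sums modulo k, and many sums from lists of colours -/

/-- The smaller of the two numbers that agree with `s` modulo `k` and lie in the same block of
length `2k` as `s`. -/
def low (k s : ℕ) : ℕ := 2 * k * (s / (2 * k)) + s % k

theorem low_cases {k : ℕ} (hk : 0 < k) (s : ℕ) : s = low k s ∨ s = low k s + k := by
  have h1 := Nat.div_add_mod s (2 * k)
  have h2 : s % (2 * k) < 2 * k := Nat.mod_lt _ (by omega)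
  have h3 : s % (2 * k) % k = s % k := Nat.mod_mul_left_mod s 2 k
  unfold low
  rcases lt_or_ge (s % (2 * k)) k with h | h
  · rw [Nat.mod_eq_of_lt h] at h3
    omega
  · rw [Nat.mod_eq_sub_mod h, Nat.mod_eq_of_lt (by omega)] at h3
    omega

theorem low_mod (k s : ℕ) : low k s % k = s % k := by
  unfold low
  rw [mul_comm 2 k, mul_assoc, Nat.mul_add_mod, Nat.mod_mod]

theorem low_low {k : ℕ} (hk : 0 < k) (s : ℕ) : low k (low k s) = low k s := by
  have hlt : s % k < k := Nat.mod_lt _ hk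
  have hd : low k s / (2 * k) = s / (2 * k) := by
    unfold low
    rw [Nat.mul_add_div (by omega), Nat.div_eq_of_lt (by omega : s % k < 2 * k), add_zero]
  rw [low, hd, low_mod]
  rfl

/-- Together with `low_low`: `low k` is constant on each pair. Distinct values of `low k` thus mean
disjoint pairs, and sums that stay distinct whichever member of its pair each vertex takes. -/
theorem low_low_add {k : ℕ} (hk : 0 < k) (s : ℕ) : low k (low k s + k) = low k s := by
  have hlt : s % k < k := Nat.mod_lt _ hk
  have hd : (low k s + k) / (2 * k) = s / (2 * k) := by
    unfold low
    rw [add_assoc, Nat.mul_add_div (by omega), Nat.div_eq_of_lt (by omega : s % k + k < 2 * k),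
      add_zero]
  rw [low, hd, Nat.add_mod_right, low_mod]
  rfl

/-- `F` stands for the later edges at a vertex, `b` for the number of earlier edges that can be
shifted by `k`. One list alone gives (q + 1)(b + 1) sums; each further list adds q sums, all larger
than those obtained by using its least element. -/
theorem exists_many_sums {ι : Type*} [DecidableEq ι] (k b q : ℕ) (F : Finset ι)
    (hF : F.Nonempty) : ∀ L : ι → Finset ℕ, (∀ t ∈ F, L t ⊆ Finset.Icc (k + 1) (2 * k)) →
      (∀ t ∈ F, q + F.card ≤ (L t).card) →
      ∃ A : Finset ℕ, F.card * q + 1 + b * (q + 1) ≤ A.card ∧ ∀ a ∈ A, ∃ x : ι → ℕ, ∃ j ≤ b,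
        (∀ t ∈ F, x t ∈ L t) ∧ Set.InjOn x F ∧ a = ∑ t ∈ F, x t + j * k := by
  induction hF using Finset.Nonempty.cons_induction with
  | singleton t =>
    intro L hL hc
    refine ⟨(L t ×ˢ Finset.range (b + 1)).image (fun p => p.1 + p.2 * k), ?_, ?_⟩
    · rw [Finset.card_image_of_injOn, Finset.card_product, Finset.card_range]
      · have := hc t (by simp)
        simp only [Finset.card_singleton] at this ⊢
        nlinarith [Nat.mul_le_mul_right (b + 1) this]
      · rintro ⟨l, j⟩ h1 ⟨l', j'⟩ h2 h
        simp only [Finset.coe_product, Set.mem_prod, Finset.mem_coe] at h1 h2 h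
        have e1 := Finset.mem_Icc.1 (hL t (by simp) h1.1)
        have e2 := Finset.mem_Icc.1 (hL t (by simp) h2.1)
        -- All lists lie in a window of length `k`, so different multiples of `k` cannot produce the
        -- same sum.
        have : j = j' := by
          rcases lt_trichotomy j j' with hj | hj | hj
          · have := Nat.mul_le_mul_right k hj
            rw [Nat.succ_mul] at this
            omega
          · exact hj
          · have := Nat.mul_le_mul_right k hj
            rw [Nat.succ_mul] at this
            omega
        subst this
        simp at h
        simp [h]
    · intro a ha
      obtain ⟨⟨l, j⟩, h1, rfl⟩ := Finset.mem_image.1 ha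
      simp only [Finset.mem_product, Finset.mem_range] at h1
      exact ⟨fun _ => l, j, by omega, by simpa using h1.1, by simp, by simp⟩
  | cons t F ht hF ih =>
    intro L hL hc
    have hne : (L t).Nonempty := by
      rw [← Finset.card_pos]
      have := hc t (by simp)
      rw [Finset.card_cons] at this
      omega
    set y := (L t).min' hne with hy
    have hymem : y ∈ L t := Finset.min'_mem _ _
    obtain ⟨A, hA, hAx⟩ := ih (fun s => (L s).erase y)
      (fun s hs => (Finset.erase_subset _ _).trans (hL s (by simp [hs])))
      (fun s hs => by
        have h1 := hc s (by simp [hs])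
        have h2 := Finset.pred_card_le_card_erase (s := L s) (a := y)
        rw [Finset.card_cons] at h1
        omega)
    have hAne : A.Nonempty := by
      rw [← Finset.card_pos]
      omega
    set m := A.max' hAne with hm
    obtain ⟨x, j, hj, hxL, hxi, hxm⟩ := hAx m (Finset.max'_mem _ _)
    -- In a choice attaining the maximum `m`, the colour `y` of `t` is replaced by a larger unused
    -- one. The list has q + |F| + 1 elements, at most |F| + 1 of which are excluded.
    set E := L t \ (insert y (F.image x)) with hE
    have hEc : q ≤ E.card := by
      rw [hE]
      have h1 := Finset.le_card_sdiff (insert y (F.image x)) (L t)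
      have h2 := Finset.card_insert_le y (F.image x)
      have h3 : (F.image x).card ≤ F.card := Finset.card_image_le
      have h4 := hc t (by simp)
      rw [Finset.card_cons] at h4
      omega
    have hext : ∀ (x : ι → ℕ) (l : ℕ), l ∈ L t → (∀ s ∈ F, x s ∈ (L s).erase y) →
        Set.InjOn x F → (∀ s ∈ F, x s ≠ l) →
        (∀ s ∈ Finset.cons t F ht, Function.update x t l s ∈ L s) ∧
        Set.InjOn (Function.update x t l) (Finset.cons t F ht) ∧
        ∑ s ∈ Finset.cons t F ht, Function.update x t l s = l + ∑ s ∈ F, x s := by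
      intro x l hl hx hxi hxl
      have hup : ∀ s ∈ F, Function.update x t l s = x s := fun s hs =>
        Function.update_of_ne (by rintro rfl; exact ht hs) _ _
      refine ⟨?_, ?_, ?_⟩
      · intro s hs
        rcases Finset.mem_cons.1 hs with rfl | hs
        · simpa using hl
        · rw [hup s hs]
          exact Finset.mem_of_mem_erase (hx s hs)
      · intro a ha b hb hab
        rcases Finset.mem_cons.1 (Finset.mem_coe.1 ha) with ha' | ha' <;>
        rcases Finset.mem_cons.1 (Finset.mem_coe.1 hb) with hb' | hb'
        · rw [ha', hb']
        · rw [hup b hb', ha', Function.update_self] at hab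
          exact absurd hab.symm (hxl b hb')
        · rw [hup a ha', hb', Function.update_self] at hab
          exact absurd hab (hxl a ha')
        · rw [hup a ha', hup b hb'] at hab
          exact hxi ha' hb' hab
      · rw [Finset.sum_cons, Function.update_self, Finset.sum_congr rfl hup]
    refine ⟨A.image (fun a => y + a) ∪ E.image (fun l => m + l), ?_, ?_⟩
    · rw [Finset.card_union_of_disjoint, Finset.card_image_of_injective _ (add_right_injective _),
        Finset.card_image_of_injective _ (add_right_injective _), Finset.card_cons]
      · nlinarith
      · rw [Finset.disjoint_left]
        rintro _ h1 h2
        obtain ⟨a, ha, rfl⟩ := Finset.mem_image.1 h1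
        obtain ⟨l, hl, h⟩ := Finset.mem_image.1 h2
        have h3 : a ≤ m := Finset.le_max' _ _ ha
        rw [hE, Finset.mem_sdiff, Finset.mem_insert] at hl
        have h4 : y ≤ l := Finset.min'_le _ _ hl.1
        exact hl.2 (Or.inl (by omega))
    · intro a ha
      rcases Finset.mem_union.1 ha with ha | ha
      · obtain ⟨a', ha', rfl⟩ := Finset.mem_image.1 ha
        obtain ⟨x, j, hj, hxL, hxi, rfl⟩ := hAx a' ha'
        obtain ⟨h1, h2, h3⟩ := hext x y hymem hxL hxi (fun s hs => Finset.ne_of_mem_erase (hxL s hs))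
        exact ⟨_, j, hj, h1, h2, by rw [h3]; ring⟩
      · obtain ⟨l, hl, rfl⟩ := Finset.mem_image.1 ha
        rw [hE, Finset.mem_sdiff, Finset.mem_insert, not_or, Finset.mem_image] at hl
        obtain ⟨h1, h2, h3⟩ := hext x l hl.1 hxL hxi (fun s hs h => hl.2.2 ⟨s, hs, h⟩)
        exact ⟨_, j, hj, h1, h2, by rw [h3, hxm]; ring⟩

/-! ### Weighted degrees, balls and spheres -/

variable {V : Type*} [Fintype V] [DecidableEq V]

theorem weightedDegree_eq_sum (G : SimpleGraph V) [DecidableRel G.Adj] (c : Sym2 V → ℕ) (v : V) :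
    weightedDegree G c v = ∑ w ∈ G.neighborFinset v, c s(v, w) := by
  unfold weightedDegree
  symm
  refine Finset.sum_bij (fun w _ => s(v, w)) ?_ ?_ ?_ ?_
  · intro w hw
    rw [SimpleGraph.mem_neighborFinset] at hw
    simpa [SimpleGraph.mk'_mem_incidenceSet_left_iff] using hw
  · intro a _ b _ h
    exact Sym2.congr_right.1 h
  · intro e he
    rw [SimpleGraph.mem_incidenceFinset] at he
    obtain ⟨w, rfl⟩ := Sym2.mem_iff_exists.1 he.2
    exact ⟨w, by simpa using he.1, rfl⟩
  · intros
    rfl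

/-- The vertices other than `v` at distance at most `r` from `v`. -/
noncomputable def punctured (G : SimpleGraph V) (r : ℕ) (v : V) : Finset V := by
  classical exact univ.filter (fun q => q ≠ v ∧ G.edist v q ≤ r)

theorem mem_punctured {G : SimpleGraph V} {r : ℕ} {v q : V} :
    q ∈ punctured G r v ↔ q ≠ v ∧ G.edist v q ≤ r := by
  simp [punctured]

theorem adj_mem_punctured {G : SimpleGraph V} {r : ℕ} (hr : 1 ≤ r) {v q : V} (h : G.Adj v q) :
    q ∈ punctured G r v := by
  rw [mem_punctured, SimpleGraph.edist_eq_one_iff_adj.2 h]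
  exact ⟨h.ne', by exact_mod_cast hr⟩

theorem edist_le_two {G : SimpleGraph V} {r : ℕ} (hr : 2 ≤ r) {v a b : V} (ha : G.Adj v a)
    (hb : G.Adj v b) : G.edist a b ≤ r := by
  refine (SimpleGraph.edist_le (.cons ha.symm (.cons hb .nil))).trans ?_
  simpa using (by exact_mod_cast hr : (2 : ℕ∞) ≤ r)

/-- The vertices at distance exactly `i` from `v`. -/
noncomputable def sphere (G : SimpleGraph V) (i : ℕ) (v : V) : Finset V := by
  classical exact univ.filter (fun q => G.edist v q = i)

theorem mem_sphere {G : SimpleGraph V} {i : ℕ} {v q : V} :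
    q ∈ sphere G i v ↔ G.edist v q = i := by
  simp [sphere]

theorem exists_mem_sphere_adj {G : SimpleGraph V} {i : ℕ} {v q : V} (h : q ∈ sphere G (i + 1) v) :
    ∃ p ∈ sphere G i v, G.Adj p q := by
  rw [mem_sphere] at h
  obtain ⟨w, hw⟩ := SimpleGraph.exists_walk_of_edist_eq_coe h
  rw [SimpleGraph.edist_comm] at h
  obtain ⟨x, hx⟩ : ∃ x, x = w.reverse := ⟨_, rfl⟩
  have hxl : x.length = i + 1 := by rw [hx, SimpleGraph.Walk.length_reverse, hw]
  clear hx hw w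
  cases x with
  | nil => simp at hxl
  | @cons _ p _ hadj y =>
    rw [SimpleGraph.Walk.length_cons] at hxl
    refine ⟨p, ?_, hadj.symm⟩
    rw [mem_sphere]
    have h1 : G.edist v p ≤ i := by
      rw [SimpleGraph.edist_comm]
      refine (SimpleGraph.edist_le y).trans ?_
      exact_mod_cast (by omega : y.length ≤ i)
    have h2 : G.edist v q ≤ G.edist v p + 1 := by
      rw [← SimpleGraph.edist_eq_one_iff_adj.2 hadj.symm]
      exact SimpleGraph.edist_triangle
    rw [SimpleGraph.edist_comm, h] at h2
    obtain ⟨n, hn⟩ := ENat.ne_top_iff_exists.1 (ne_top_of_le_ne_top (ENat.natCast_ne_top i) h1)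
    rw [← hn] at h1 h2 ⊢
    norm_cast at *
    omega

/-- A vertex of a sphere of positive radius has a neighbour on the preceding sphere, so at most Δ -
1 on the next. The first factor is kept as the degree of `v`, since the number of sums available at
`v` also scales with its degree. -/
theorem card_sphere_succ_le (G : SimpleGraph V) [DecidableRel G.Adj] {Δ : ℕ}
    (hΔ : ∀ v, G.degree v ≤ Δ) (v : V) (i : ℕ) :
    (sphere G (i + 1) v).card ≤ G.degree v * (Δ - 1) ^ i := by
  induction i with
  | zero =>
    rw [pow_zero, mul_one, ← SimpleGraph.card_neighborFinset_eq_degree]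
    refine Finset.card_le_card fun q hq => ?_
    rw [mem_sphere] at hq
    rw [SimpleGraph.mem_neighborFinset, ← SimpleGraph.edist_eq_one_iff_adj]
    simpa using hq
  | succ i ih =>
    have hsub : sphere G (i + 2) v ⊆ (sphere G (i + 1) v).biUnion
        (fun p => (G.neighborFinset p) ∩ sphere G (i + 2) v) := by
      intro q hq
      obtain ⟨p, hp, hpq⟩ := exists_mem_sphere_adj hq
      simp only [mem_biUnion, mem_inter, SimpleGraph.mem_neighborFinset]
      exact ⟨p, hp, hpq, hq⟩
    refine (Finset.card_le_card hsub).trans ((Finset.card_biUnion_le_card_mul _ _ (Δ - 1) ?_).trans ?_)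
    · intro p hp
      obtain ⟨a, ha, hap⟩ := exists_mem_sphere_adj hp
      have h1 : G.neighborFinset p ∩ sphere G (i + 2) v ⊆ (G.neighborFinset p).erase a := by
        intro q hq
        rw [mem_inter] at hq
        rw [mem_erase]
        refine ⟨?_, hq.1⟩
        rintro rfl
        have h2 := mem_sphere.1 hq.2
        rw [mem_sphere.1 ha] at h2
        norm_cast at h2
        omega
      have h2 := Finset.card_le_card h1
      rw [card_erase_of_mem (by simpa using hap.symm),
        SimpleGraph.card_neighborFinset_eq_degree] at h2
      have := hΔ p
      omega
    · rw [pow_succ, ← mul_assoc]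
      exact Nat.mul_le_mul_right _ ih

theorem card_punctured_le (G : SimpleGraph V) [DecidableRel G.Adj] {Δ : ℕ}
    (hΔ : ∀ v, G.degree v ≤ Δ) (r : ℕ) (v : V) :
    (punctured G r v).card ≤ G.degree v * ∑ i ∈ range r, (Δ - 1) ^ i := by
  have hsub : punctured G r v ⊆ (range r).biUnion (fun i => sphere G (i + 1) v) := by
    intro q hq
    obtain ⟨hne, hle⟩ := mem_punctured.1 hq
    obtain ⟨n, hn⟩ := ENat.ne_top_iff_exists.1 (ne_top_of_le_ne_top (ENat.natCast_ne_top r) hle)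
    have h0 : n ≠ 0 := by
      rintro rfl
      exact hne (SimpleGraph.edist_eq_zero_iff.1 hn.symm).symm
    rw [← hn] at hle
    norm_cast at hle
    simp only [mem_biUnion, mem_range, mem_sphere]
    exact ⟨n - 1, by omega, by rw [← hn]; congr; omega⟩
  refine (Finset.card_le_card hsub).trans (Finset.card_biUnion_le.trans ?_)
  rw [mul_sum]
  exact Finset.sum_le_sum fun i _ => card_sphere_succ_le G hΔ v i

/-! ### Recolouring the edges at one vertex -/

/-- The colouring `c`, changed at the pairs `s(v, w)`, which receive the colour `g w`. -/
def recolour (c : Sym2 V → ℕ) (v : V) (g : V → ℕ) (e : Sym2 V) : ℕ :=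
  if h : v ∈ e then g (Sym2.Mem.other' h) else c e

theorem recolour_left (c : Sym2 V → ℕ) (v : V) (g : V → ℕ) (w : V) :
    recolour c v g s(v, w) = g w := by
  have h : v ∈ s(v, w) := Sym2.mem_mk_left v w
  rw [recolour, dif_pos h]
  congr 1
  exact Sym2.congr_right.1 (Sym2.other_spec' h)

theorem recolour_right (c : Sym2 V → ℕ) (v : V) (g : V → ℕ) (w : V) :
    recolour c v g s(w, v) = g w := by
  rw [Sym2.eq_swap, recolour_left]

theorem recolour_of_ne (c : Sym2 V → ℕ) {v : V} (g : V → ℕ) {a b : V} (ha : a ≠ v) (hb : b ≠ v) :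
    recolour c v g s(a, b) = c s(a, b) := by
  rw [recolour, dif_neg]
  rw [Sym2.mem_iff]
  rintro (h | h)
  · exact ha h.symm
  · exact hb h.symm

section
variable (G : SimpleGraph V) [DecidableRel G.Adj]

theorem weightedDegree_recolour_self (c : Sym2 V → ℕ) (v : V) (g : V → ℕ) :
    weightedDegree G (recolour c v g) v = ∑ w ∈ G.neighborFinset v, g w := by
  rw [weightedDegree_eq_sum]
  exact sum_congr rfl fun w _ => recolour_left c v g w

theorem weightedDegree_congr {c c' : Sym2 V → ℕ} {p : V} (h : ∀ w, G.Adj p w → c' s(p, w) = c s(p, w)) :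
    weightedDegree G c' p = weightedDegree G c p := by
  rw [weightedDegree_eq_sum, weightedDegree_eq_sum]
  exact sum_congr rfl fun w hw => h w (by simpa using hw)

theorem weightedDegree_recolour_of_not_adj (c : Sym2 V → ℕ) {v : V} (g : V → ℕ) {p : V}
    (hp : p ≠ v) (h : ¬ G.Adj v p) :
    weightedDegree G (recolour c v g) p = weightedDegree G c p :=
  weightedDegree_congr G fun _ hw =>
    recolour_of_ne c g hp (by rintro rfl; exact h hw.symm)

theorem weightedDegree_recolour_of_adj (c : Sym2 V → ℕ) {v : V} (g : V → ℕ) {p : V}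
    (h : G.Adj v p) :
    weightedDegree G (recolour c v g) p + c s(v, p) = weightedDegree G c p + g p := by
  rw [weightedDegree_eq_sum, weightedDegree_eq_sum]
  have hv : v ∈ G.neighborFinset p := by simpa using h.symm
  rw [← add_sum_erase _ _ hv, ← add_sum_erase _ (fun w => c s(p, w)) hv, recolour_right,
    Sym2.eq_swap (a := p)]
  have : ∑ w ∈ (G.neighborFinset p).erase v, recolour c v g s(p, w) =
      ∑ w ∈ (G.neighborFinset p).erase v, c s(p, w) :=
    sum_congr rfl fun w hw => recolour_of_ne c g h.ne' (ne_of_mem_erase hw)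
  rw [this]
  ring

/-- The recolouring of the edges at `v` which gives a vertex `w` of `T` the larger of its two
sums if `w ∈ Y` and the smaller one otherwise, and gives the colour `f w` to the other edges
`s(v, w)`. -/
def reset (k : ℕ) (c : Sym2 V → ℕ) (v : V) (T Y : Finset V) (f : V → ℕ) : Sym2 V → ℕ :=
  recolour c v fun w =>
    if w ∈ T then
      c s(v, w) + (low k (weightedDegree G c w) + if w ∈ Y then k else 0) - weightedDegree G c w
    else f w

/-- What the edges from `v` to `T` contribute to the sum of `v` if all vertices of `T` take the
smaller of their two sums. -/
def baseSum (k : ℕ) (c : Sym2 V → ℕ) (v : V) (T : Finset V) : ℕ :=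
  ∑ w ∈ T, (c s(v, w) + low k (weightedDegree G c w) - weightedDegree G c w)

variable {k : ℕ} (c : Sym2 V → ℕ) {v : V} {T Y : Finset V} (f : V → ℕ)

theorem reset_left_of_notMem {w : V} (hw : w ∉ T) : reset G k c v T Y f s(v, w) = f w := by
  rw [reset, recolour_left, if_neg hw]

theorem reset_of_ne {a b : V} (ha : a ≠ v) (hb : b ≠ v) :
    reset G k c v T Y f s(a, b) = c s(a, b) :=
  recolour_of_ne c _ ha hb

theorem weightedDegree_reset_of_not_adj {p : V} (hp : p ≠ v) (h : ¬ G.Adj v p) :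
    weightedDegree G (reset G k c v T Y f) p = weightedDegree G c p :=
  weightedDegree_recolour_of_not_adj G c _ hp h

/-- For the second of two resets, at `z`, which must leave the edge `s(u, z)` and hence the sum of
`u` alone. -/
theorem weightedDegree_reset_of_eq {p : V} (hp : p ≠ v) (hpT : p ∉ T) (h : f p = c s(v, p)) :
    weightedDegree G (reset G k c v T Y f) p = weightedDegree G c p := by
  by_cases hadj : G.Adj v p
  · have := weightedDegree_recolour_of_adj G c (fun w =>
      if w ∈ T then
        c s(v, w) + (low k (weightedDegree G c w) + if w ∈ Y then k else 0) - weightedDegree G c w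
      else f w) hadj
    simp only [if_neg hpT, h] at this
    exact Nat.add_right_cancel this
  · exact weightedDegree_reset_of_not_adj G c f hp hadj

/-- The truncated subtraction in `reset` is exact: the sum exceeds its `low` by at most `k`, which
is less than the colour. -/
theorem reset_left_of_mem (hk : 0 < k) {w : V} (hw : w ∈ T) (hc : k < c s(v, w)) :
    reset G k c v T Y f s(v, w) + weightedDegree G c w =
      c s(v, w) + (low k (weightedDegree G c w) + if w ∈ Y then k else 0) := by
  rw [reset, recolour_left, if_pos hw]
  have := low_cases hk (weightedDegree G c w)
  omega

theorem reset_left_bounds (hk : 0 < k) {w : V} (hw : w ∈ T) (hc : k < c s(v, w)) (hc' : c s(v, w) ≤ 2 * k) :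
    1 ≤ reset G k c v T Y f s(v, w) ∧ reset G k c v T Y f s(v, w) ≤ 3 * k := by
  have h1 := reset_left_of_mem G c (Y := Y) f hk hw hc
  have h2 := low_cases hk (weightedDegree G c w)
  split_ifs at h1 <;> omega

theorem reset_left_mod (hk : 0 < k) {w : V} (hw : w ∈ T) (hc : k < c s(v, w)) :
    reset G k c v T Y f s(v, w) % k = c s(v, w) % k := by
  have h1 := reset_left_of_mem G c (Y := Y) f hk hw hc
  have h2 : weightedDegree G c w ≡ low k (weightedDegree G c w) + (if w ∈ Y then k else 0) [MOD k] := by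
    split_ifs
    · exact ((low_mod k _).symm.trans (Nat.add_mod_right _ _).symm)
    · exact (low_mod k _).symm
  refine Nat.ModEq.add_right_cancel h2 ?_
  rw [← h1]

theorem weightedDegree_reset_of_mem (hk : 0 < k) {w : V} (hadj : G.Adj v w) (hw : w ∈ T) (hc : k < c s(v, w)) :
    weightedDegree G (reset G k c v T Y f) w =
      low k (weightedDegree G c w) + if w ∈ Y then k else 0 := by
  have h1 := reset_left_of_mem G c (Y := Y) f hk hw hc
  have h2 := weightedDegree_recolour_of_adj G c (fun w =>
      if w ∈ T then
        c s(v, w) + (low k (weightedDegree G c w) + if w ∈ Y then k else 0) - weightedDegree G c w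
      else f w) hadj
  rw [reset, recolour_left] at h1
  rw [reset]
  omega

theorem low_weightedDegree_reset (hk : 0 < k) {w : V} (hadj : G.Adj v w) (hw : w ∈ T) (hc : k < c s(v, w)) :
    low k (weightedDegree G (reset G k c v T Y f) w) = low k (weightedDegree G c w) := by
  rw [weightedDegree_reset_of_mem G c f hk hadj hw hc]
  split_ifs
  · exact low_low_add hk _
  · exact low_low hk _

theorem weightedDegree_reset_self (hk : 0 < k) (hT : ∀ w ∈ T, G.Adj v w ∧ k < c s(v, w)) (hY : Y ⊆ T) :
    weightedDegree G (reset G k c v T Y f) v =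
      baseSum G k c v T + k * Y.card + ∑ w ∈ G.neighborFinset v \ T, f w := by
  have hTN : T ⊆ G.neighborFinset v := fun w hw => by simpa using (hT w hw).1
  rw [reset, weightedDegree_recolour_self, ← sum_sdiff hTN, add_comm]
  congr 1
  · have h1 : ∀ w ∈ T, (if w ∈ T then
        c s(v, w) + (low k (weightedDegree G c w) + if w ∈ Y then k else 0) - weightedDegree G c w
      else f w) = (c s(v, w) + low k (weightedDegree G c w) - weightedDegree G c w) +
        if w ∈ Y then k else 0 := by
      intro w hw
      rw [if_pos hw]
      have := (hT w hw).2
      have := low_cases hk (weightedDegree G c w)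
      omega
    rw [sum_congr rfl h1, sum_add_distrib, baseSum, ← sum_filter, filter_mem_eq_inter,
      inter_eq_right.2 hY, sum_const, smul_eq_mul, mul_comm k]
  · exact sum_congr rfl fun w hw => if_neg (mem_sdiff.1 hw).2

/-- Shifts do not affect residues, so the residue of the sum at `v` is known before it is decided
which neighbours take which sum. -/
theorem baseSum_mod (hk : 0 < k) (hT : ∀ w ∈ T, k < c s(v, w)) :
    baseSum G k c v T % k = (∑ w ∈ T, c s(v, w)) % k := by
  rw [baseSum, sum_nat_mod, sum_nat_mod T k (fun w => c s(v, w))]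
  congr 1
  refine sum_congr rfl fun w hw => ?_
  have h1 := hT w hw
  have h2 := low_cases hk (weightedDegree G c w)
  rcases h2 with h2 | h2
  · rw [← h2, Nat.add_sub_cancel]
  · have h3 : c s(v, w) = (c s(v, w) + low k (weightedDegree G c w) - weightedDegree G c w) + k := by
      omega
    conv_rhs => rw [h3, Nat.add_mod_right]

end

/-! ### Processing the vertices one by one -/

/-- `c` is a colouring of the edges with an end in `P` which is proper modulo `k`, leaves room for
shifts by `k` on the edges leaving `P`, and separates the vertices of `P` at distance at most `r`
even if their sums are changed inside their pairs. -/
structure IsPartialColouring (G : SimpleGraph V) [DecidableRel G.Adj] (r k : ℕ) (P : Finset V)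
    (c : Sym2 V → ℕ) : Prop where
  inner : ∀ p ∈ P, ∀ q ∈ P, G.Adj p q → 1 ≤ c s(p, q) ∧ c s(p, q) ≤ 3 * k
  outer : ∀ p ∈ P, ∀ q ∉ P, G.Adj p q → k < c s(p, q) ∧ c s(p, q) ≤ 2 * k
  proper : ∀ x a b, a ≠ b → G.Adj x a → G.Adj x b → (x ∈ P ∨ a ∈ P) → (x ∈ P ∨ b ∈ P) →
    c s(x, a) % k ≠ c s(x, b) % k
  distinct : ∀ p ∈ P, ∀ q ∈ P, p ≠ q → G.edist p q ≤ r →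
    low k (weightedDegree G c p) ≠ low k (weightedDegree G c q)

theorem isPartialColouring_empty (G : SimpleGraph V) [DecidableRel G.Adj] (r k : ℕ)
    (c : Sym2 V → ℕ) : IsPartialColouring G r k ∅ c :=
  ⟨by simp, by simp, by simp, by simp⟩

theorem mod_inj_of_mem_Icc {a k x y : ℕ} (hx : x ∈ Icc (a + 1) (a + k)) (hy : y ∈ Icc (a + 1) (a + k))
    (h : x % k = y % k) : x = y := by
  wlog hxy : x ≤ y generalizing x y
  · exact (this hy hx h.symm (by omega)).symm
  rw [mem_Icc] at hx hy
  have h1 := (Nat.modEq_iff_dvd' hxy).1 h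
  have h2 := Nat.eq_zero_of_dvd_of_lt h1 (by omega)
  omega

theorem card_filter_mod_notMem (a k : ℕ) (R : Finset ℕ) :
    k ≤ ((Icc (a + 1) (a + k)).filter (fun x => x % k ∉ R)).card + R.card := by
  have h1 := card_filter_add_card_filter_not (s := Icc (a + 1) (a + k)) (fun x => x % k ∉ R)
  have h2 : ((Icc (a + 1) (a + k)).filter (fun x => ¬ x % k ∉ R)).card ≤ R.card := by
    refine card_le_card_of_injOn (fun x => x % k) ?_ ?_
    · intro x hx
      simpa using (mem_filter.1 hx).2
    · intro x hx y hy h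
      exact mod_inj_of_mem_Icc (mem_filter.1 hx).1 (mem_filter.1 hy).1 h
  rw [Nat.card_Icc] at h1
  omega

/-- With f ≥ 1 later and b earlier neighbours, `v` has at least f(2S - 1) + 1 + 2Sb possible sums.
The processed vertices in its ball number at most (f + b)S - f and forbid two sums each, so at least
f + 1 possibilities remain. -/
theorem IsPartialColouring.exists_insert {G : SimpleGraph V} [DecidableRel G.Adj] {Δ r S k : ℕ}
    {P : Finset V} {c : Sym2 V → ℕ} {v : V} (h : IsPartialColouring G r k P c) (hr : 1 ≤ r)
    (hΔ : ∀ v, G.degree v ≤ Δ) (hS : ∀ v, (punctured G r v).card ≤ G.degree v * S) (hS1 : 1 ≤ S)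
    (hk : k + 2 = 2 * S + 2 * Δ) (hv : v ∉ P) (hfwd : ∃ t, G.Adj v t ∧ t ∉ P) :
    ∃ c', IsPartialColouring G r k (insert v P) c' := by
  obtain ⟨t₀, ht₀, ht₀P⟩ := hfwd
  have hdpos : 1 ≤ G.degree v := by
    rw [← SimpleGraph.card_neighborFinset_eq_degree]
    exact card_pos.2 ⟨t₀, by simpa using ht₀⟩
  have hk0 : 0 < k := by
    have := hΔ v
    omega
  have hne : ∀ p ∈ P, p ≠ v := fun p hp hpv => hv (hpv ▸ hp)
  set T := (G.neighborFinset v).filter (· ∈ P) with hTdef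
  set F := G.neighborFinset v \ T with hFdef
  have hmT : ∀ w, w ∈ T ↔ G.Adj v w ∧ w ∈ P := fun w => by simp [hTdef]
  have hmF : ∀ w, w ∈ F ↔ G.Adj v w ∧ w ∉ P := fun w => by
    rw [hFdef, mem_sdiff, hmT, SimpleGraph.mem_neighborFinset]
    tauto
  have hcard : F.card + T.card = G.degree v := by
    rw [hFdef, ← SimpleGraph.card_neighborFinset_eq_degree]
    exact card_sdiff_add_card_eq_card (filter_subset _ _)
  have hT : ∀ w ∈ T, G.Adj v w ∧ k < c s(v, w) := fun w hw => by
    have := (hmT w).1 hw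
    rw [Sym2.eq_swap]
    exact ⟨this.1, (h.outer w this.2 v hv this.1.symm).1⟩
  have hT2 : ∀ w ∈ T, c s(v, w) ≤ 2 * k := fun w hw => by
    have := (hmT w).1 hw
    rw [Sym2.eq_swap]
    exact (h.outer w this.2 v hv this.1.symm).2
  -- The residues forbidden for `s(v, t)`: those of the coloured edges at `v` and at `t`.
  let R : V → Finset ℕ := fun t => T.image (fun w => c s(v, w) % k) ∪
    ((G.neighborFinset t).filter (· ∈ P)).image (fun w => c s(t, w) % k)
  let L : V → Finset ℕ := fun t => (Icc (k + 1) (k + k)).filter (fun x => x % k ∉ R t)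
  have hF0 : F.Nonempty := ⟨t₀, (hmF t₀).2 ⟨ht₀, ht₀P⟩⟩
  have hL : ∀ t ∈ F, L t ⊆ Icc (k + 1) (2 * k) := fun t _ => by
    rw [two_mul]
    exact filter_subset _ _
  -- At most |T| + Δ - 1 residues are forbidden, and k - |T| - (Δ - 1) = 2S - 1 + (Δ - |T|) with Δ -
  -- |T| ≥ |F|.
  have hLc : ∀ t ∈ F, (2 * S - 1) + F.card ≤ (L t).card := by
    intro t ht
    have h1 : k ≤ (L t).card + (R t).card := card_filter_mod_notMem k k (R t)
    have h2 : (R t).card ≤ T.card + (Δ - 1) := by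
      refine (card_union_le _ _).trans (Nat.add_le_add card_image_le (card_image_le.trans ?_))
      have h3 : (G.neighborFinset t).filter (· ∈ P) ⊆ (G.neighborFinset t).erase v := by
        intro w hw
        rw [mem_filter] at hw
        exact mem_erase.2 ⟨by rintro rfl; exact hv hw.2, hw.1⟩
      have h4 := card_le_card h3
      rw [card_erase_of_mem (by simpa using ((hmF t).1 ht).1.symm),
        SimpleGraph.card_neighborFinset_eq_degree] at h4
      have := hΔ t
      omega
    have := hΔ v
    omega
  obtain ⟨A, hA, hAx⟩ := exists_many_sums k T.card (2 * S - 1) F hF0 L hL hLc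
  let B : Finset ℕ := (punctured G r v ∩ P).biUnion fun p =>
    {low k (weightedDegree G c p), low k (weightedDegree G c p) + k}
  have hB : B.card ≤ 2 * (punctured G r v ∩ P).card := by
    rw [mul_comm]
    exact card_biUnion_le_card_mul _ _ _ fun p _ => card_le_two
  have hBF : (punctured G r v ∩ P).card + F.card ≤ G.degree v * S := by
    rw [← card_union_of_disjoint]
    · refine (card_le_card (union_subset inter_subset_left fun t ht => ?_)).trans (hS v)
      exact adj_mem_punctured hr ((hmF t).1 ht).1
    · rw [disjoint_left]
      intro t h1 h2
      exact ((hmF t).1 h2).2 (mem_inter.1 h1).2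
  obtain ⟨a, haA, haB⟩ : ∃ a ∈ A, baseSum G k c v T + a ∉ B := by
    by_contra! hcon
    have h1 : A.card ≤ B.card :=
      card_le_card_of_injOn (fun a => baseSum G k c v T + a) hcon (add_right_injective _).injOn
    obtain ⟨S', rfl⟩ : ∃ S', S = S' + 1 := ⟨S - 1, by omega⟩
    rw [← hcard] at hBF
    have h2 : 2 * (S' + 1) - 1 = 2 * S' + 1 := by omega
    rw [h2] at hA
    have h3 : 1 ≤ F.card := card_pos.2 hF0
    nlinarith
  obtain ⟨x, j, hj, hxL, hxi, rfl⟩ := hAx a haA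
  obtain ⟨Y, hYT, hYj⟩ := exists_subset_card_eq hj
  have hxR : ∀ t ∈ F, k < x t ∧ x t ≤ 2 * k := fun t ht => by
    have := mem_Icc.1 (hL t ht (hxL t ht))
    omega
  have hself : weightedDegree G (reset G k c v T Y x) v =
      baseSum G k c v T + (∑ t ∈ F, x t + j * k) := by
    rw [weightedDegree_reset_self G c x hk0 hT hYT, hYj]
    ring
  have hlow : ∀ p ∈ P, low k (weightedDegree G (reset G k c v T Y x) p) =
      low k (weightedDegree G c p) := by
    intro p hp
    by_cases hadj : G.Adj v p
    · have hpT := (hmT p).2 ⟨hadj, hp⟩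
      exact low_weightedDegree_reset G c x hk0 hadj hpT (hT p hpT).2
    · rw [weightedDegree_reset_of_not_adj G c x (hne p hp) hadj]
  have hvp : ∀ p ∈ P, G.edist v p ≤ r → low k (weightedDegree G (reset G k c v T Y x) v) ≠
      low k (weightedDegree G (reset G k c v T Y x) p) := by
    intro p hp hd heq
    rw [hlow p hp] at heq
    apply haB
    rw [← hself]
    refine mem_biUnion.2 ⟨p, mem_inter.2 ⟨mem_punctured.2 ⟨hne p hp, hd⟩, hp⟩, ?_⟩
    rw [← heq, mem_insert, mem_singleton]
    exact low_cases hk0 _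
  have hnew : ∀ a, G.Adj v a → (a ∈ T ∧ reset G k c v T Y x s(v, a) % k = c s(v, a) % k) ∨
      (a ∈ F ∧ reset G k c v T Y x s(v, a) = x a) := by
    intro a ha
    by_cases haP : a ∈ P
    · have haT := (hmT a).2 ⟨ha, haP⟩
      exact Or.inl ⟨haT, reset_left_mod G c x hk0 haT (hT a haT).2⟩
    · have haF := (hmF a).2 ⟨ha, haP⟩
      exact Or.inr ⟨haF, reset_left_of_notMem G c x (mem_sdiff.1 haF).2⟩
  have hxT : ∀ t ∈ F, ∀ w ∈ T, x t % k ≠ c s(v, w) % k := fun t ht w hw heq =>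
    (mem_filter.1 (hxL t ht)).2 (mem_union_left _ (mem_image.2 ⟨w, hw, heq.symm⟩))
  have hxP : ∀ t ∈ F, ∀ w ∈ P, G.Adj t w → x t % k ≠ c s(t, w) % k := fun t ht w hw hadj heq =>
    (mem_filter.1 (hxL t ht)).2 (mem_union_right _ (mem_image.2
      ⟨w, mem_filter.2 ⟨by simpa using hadj, hw⟩, heq.symm⟩))
  have hprop : ∀ y b, b ≠ v → G.Adj y v → G.Adj y b → (y ∈ P ∨ b ∈ P) →
      reset G k c v T Y x s(y, v) % k ≠ reset G k c v T Y x s(y, b) % k := by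
    intro y b hb hyv hyb hor
    rw [reset_of_ne G c x hyv.ne hb, Sym2.eq_swap]
    rcases hnew y hyv.symm with ⟨h1, h2⟩ | ⟨h1, h2⟩
    · rw [h2, Sym2.eq_swap]
      exact h.proper y v b hb.symm hyv hyb (Or.inl ((hmT y).1 h1).2) hor
    · rw [h2]
      exact hxP y h1 b (hor.resolve_left ((hmF y).1 h1).2) hyb
  refine ⟨reset G k c v T Y x, ?_, ?_, ?_, ?_⟩
  · have hvq : ∀ q ∈ P, G.Adj v q → 1 ≤ reset G k c v T Y x s(v, q) ∧
        reset G k c v T Y x s(v, q) ≤ 3 * k := fun q hq hadj => by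
      have hqT := (hmT q).2 ⟨hadj, hq⟩
      exact reset_left_bounds G c x hk0 hqT (hT q hqT).2 (hT2 q hqT)
    intro p hp q hq hadj
    rcases mem_insert.1 hp with hpv | hpP
    · subst hpv
      exact hvq q ((mem_insert.1 hq).resolve_left hadj.ne') hadj
    · rcases mem_insert.1 hq with hqv | hqP
      · subst hqv
        rw [Sym2.eq_swap]
        exact hvq p hpP hadj.symm
      · rw [reset_of_ne G c x (hne p hpP) (hne q hqP)]
        exact h.inner p hpP q hqP hadj
  · intro p hp q hq hadj
    rw [mem_insert, not_or] at hq
    rcases mem_insert.1 hp with hpv | hpP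
    · subst hpv
      have hqF := (hmF q).2 ⟨hadj, hq.2⟩
      rw [reset_left_of_notMem G c x (mem_sdiff.1 hqF).2]
      exact hxR q hqF
    · rw [reset_of_ne G c x (hne p hpP) hq.1]
      exact h.outer p hpP q hq.2 hadj
  · intro y a b hab hya hyb ha hb
    rw [mem_insert, mem_insert] at ha hb
    by_cases hyv : y = v
    · subst hyv
      rcases hnew a hya with ⟨h1, h2⟩ | ⟨h1, h2⟩ <;> rcases hnew b hyb with ⟨h3, h4⟩ | ⟨h3, h4⟩ <;>
        rw [h2, h4]
      · exact h.proper y a b hab hya hyb (Or.inr ((hmT a).1 h1).2) (Or.inr ((hmT b).1 h3).2)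
      · exact (hxT b h3 a h1).symm
      · exact hxT a h1 b h3
      · intro heq
        have e1 := hL a h1 (hxL a h1)
        have e2 := hL b h3 (hxL b h3)
        rw [two_mul] at e1 e2
        exact hab (hxi h1 h3 (mod_inj_of_mem_Icc e1 e2 heq))
    · by_cases hav : a = v
      · subst hav
        exact hprop y b hab.symm hya hyb
          (hb.imp (fun e => e.resolve_left hyv) fun e => e.resolve_left hab.symm)
      · have ha' : y ∈ P ∨ a ∈ P :=
          ha.imp (fun e => e.resolve_left hyv) fun e => e.resolve_left hav
        by_cases hbv : b = v
        · subst hbv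
          exact (hprop y a hab hyb hya ha').symm
        · rw [reset_of_ne G c x hyv hav, reset_of_ne G c x hyv hbv]
          exact h.proper y a b hab hya hyb ha'
            (hb.imp (fun e => e.resolve_left hyv) fun e => e.resolve_left hbv)
  · intro p hp q hq hpq hd
    rcases mem_insert.1 hp with hpv | hpP
    · subst hpv
      exact hvp q ((mem_insert.1 hq).resolve_left hpq.symm) hd
    · rcases mem_insert.1 hq with hqv | hqP
      · subst hqv
        rw [SimpleGraph.edist_comm] at hd
        exact (hvp p hpP hd).symm
      · rw [hlow p hpP, hlow q hqP]
        exact h.distinct p hpP q hqP hpq hd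

/-- All vertices of a set other than `u` and `z` can be processed if each vertex of the set other
than `z` has a neighbour in the set that is closer to `z`. -/
theorem exists_isPartialColouring_sdiff {G : SimpleGraph V} [DecidableRel G.Adj] {Δ r S k : ℕ}
    (hr : 1 ≤ r) (hΔ : ∀ v, G.degree v ≤ Δ)
    (hS : ∀ v, (punctured G r v).card ≤ G.degree v * S) (hS1 : 1 ≤ S)
    (hk : k + 2 = 2 * S + 2 * Δ) {C : Finset V} {u z : V} (δ : V → ℕ)
    (hC : ∀ q ∈ C, q ≠ z → ∃ t ∈ C, G.Adj q t ∧ δ t < δ q) (hu : G.Adj u z) (hδ : δ z < δ u)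
    (huC : u ∈ C) (hzC : z ∈ C) :
    ∃ c, IsPartialColouring G r k (C \ {u, z}) c := by
  -- `Q` is the set of vertices still to be processed.
  suffices H : ∀ n, ∀ Q ⊆ C, Q.card = n → u ∈ Q → z ∈ Q →
      (∀ q ∈ Q, q ≠ z → ∃ t ∈ Q, G.Adj q t ∧ δ t < δ q) →
      (∃ c, IsPartialColouring G r k (C \ Q) c) →
      ∃ c, IsPartialColouring G r k (C \ {u, z}) c from
    H _ C le_rfl rfl huC hzC hC ⟨fun _ => 0, by
      rw [sdiff_self]
      exact isPartialColouring_empty G r k _⟩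
  intro n
  induction n with
  | zero =>
    intro Q _ hQ0 huQ
    rw [card_eq_zero.1 hQ0] at huQ
    simp at huQ
  | succ n ih =>
    intro Q hQC hQn huQ hzQ hQ ⟨c, hc⟩
    by_cases hE : Q \ {u, z} = ∅
    · have : Q = {u, z} := by
        refine subset_antisymm (sdiff_eq_empty_iff_subset.1 hE) ?_
        intro x hx
        rcases mem_insert.1 hx with rfl | hx
        · exact huQ
        · rw [mem_singleton.1 hx]
          exact hzQ
      rw [this] at hc
      exact ⟨c, hc⟩
    -- Removing a vertex farthest from `z` takes the closer neighbour away from no vertex other than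
    -- possibly `u`, and `u` can always use `z`.
    · obtain ⟨v, hvQ', hvmax⟩ := exists_max_image (Q \ {u, z}) δ (nonempty_iff_ne_empty.2 hE)
      have hvQ := (mem_sdiff.1 hvQ').1
      have hv2 := (mem_sdiff.1 hvQ').2
      rw [mem_insert, mem_singleton, not_or] at hv2
      obtain ⟨t, htQ, hvt, -⟩ := hQ v hvQ hv2.2
      have hins : C \ Q.erase v = insert v (C \ Q) := by
        ext x
        simp only [mem_sdiff, mem_erase, mem_insert, not_and]
        by_cases hx : x = v
        · subst hx
          simp [hQC hvQ]
        · simp [hx]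
      refine ih (Q.erase v) ((erase_subset _ _).trans hQC) (by rw [card_erase_of_mem hvQ]; omega)
        (mem_erase.2 ⟨Ne.symm hv2.1, huQ⟩) (mem_erase.2 ⟨Ne.symm hv2.2, hzQ⟩) ?_ ?_
      · intro q hq hqz
        rw [mem_erase] at hq
        by_cases hqu : q = u
        · exact ⟨z, mem_erase.2 ⟨Ne.symm hv2.2, hzQ⟩, hqu ▸ hu, hqu ▸ hδ⟩
        · obtain ⟨t, ht, hqt, hlt⟩ := hQ q hq.2 hqz
          refine ⟨t, mem_erase.2 ⟨?_, ht⟩, hqt, hlt⟩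
          rintro rfl
          have := hvmax q (by simp [hq.2, hqu, hqz])
          omega
      · rw [hins]
        exact hc.exists_insert hr hΔ hS hS1 hk (by simp [hvQ]) ⟨t, hvt, by simp [htQ]⟩

/-! ### Counting for the last two vertices -/

/-- Each `w ∈ T` takes the value `lo w`, or `lo w + k` if it is put into `Y`, while `σ + k * #Y`
is to avoid these values and the values in `B`. -/
theorem exists_subset_avoiding {ι : Type*} [DecidableEq ι] {T : Finset ι} {k σ : ℕ} (hk : 0 < k)
    {lo : ι → ℕ} (hlo : ∀ a ∈ T, ∀ b ∈ T, a ≠ b → lo a ≠ lo b ∧ lo a ≠ lo b + k) (B : Finset ℕ)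
    (hcard : B.card + (T.filter (fun w => lo w % k = σ % k)).card ≤ T.card)
    (hT : 2 ≤ T.card ∨ T.filter (fun w => lo w % k = σ % k) = ∅) :
    ∃ Y ⊆ T, σ + k * Y.card ∉ B ∧ ∀ w ∈ T, σ + k * Y.card ≠ lo w + if w ∈ Y then k else 0 := by
  by_contra! hcon
  set D := T.filter (fun w => lo w % k = σ % k) with hD
  -- Only the size of `Y` affects the left-hand value. If it equals `lo w`, put `w` into `Y`,
  -- possible unless j = 0; if it equals `lo w + k`, leave `w` out, possible unless j = |T|. The
  -- pairs are disjoint, so no other vertex interferes.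
  have key : ∀ j ∈ range (T.card + 1), σ + k * j ∉ B →
      ∃ w ∈ D, (j = 0 ∧ lo w = σ) ∨ (j = T.card ∧ lo w + k = σ + k * j) := by
    intro j hj hjB
    rw [mem_range] at hj
    have hfail : ∀ Y ⊆ T, Y.card = j → ∃ w ∈ T, σ + k * j = lo w + if w ∈ Y then k else 0 := by
      rintro Y hY rfl
      exact hcon Y hY hjB
    by_cases h1 : ∃ w ∈ T, σ + k * j = lo w
    · obtain ⟨w, hw, hjw⟩ := h1
      by_cases hj0 : j = 0
      · subst hj0
        exact ⟨w, mem_filter.2 ⟨hw, by rw [← hjw]; simp⟩, Or.inl ⟨rfl, by rw [← hjw]; simp⟩⟩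
      · obtain ⟨Y, hwY, hYT, hYj⟩ := exists_subsuperset_card_eq (singleton_subset_iff.2 hw)
          (by rw [card_singleton]; omega : ({w} : Finset ι).card ≤ j) (by omega)
        obtain ⟨a, ha, hja⟩ := hfail Y hYT hYj
        by_cases haw : a = w
        · subst haw
          rw [if_pos (singleton_subset_iff.1 hwY)] at hja
          omega
        · have := hlo w hw a ha (Ne.symm haw)
          split_ifs at hja <;> omega
    · by_cases h2 : ∃ w ∈ T, σ + k * j = lo w + k
      · obtain ⟨w, hw, hjw⟩ := h2
        by_cases hjT : j = T.card
        · refine ⟨w, mem_filter.2 ⟨hw, ?_⟩, Or.inr ⟨hjT, hjw.symm⟩⟩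
          rw [← Nat.add_mod_right, ← hjw, Nat.add_mul_mod_self_left]
        · obtain ⟨Y, hYT, hYj⟩ := exists_subset_card_eq
            (by rw [card_erase_of_mem hw]; omega : j ≤ (T.erase w).card)
          obtain ⟨a, ha, hja⟩ := hfail Y (hYT.trans (erase_subset _ _)) hYj
          split_ifs at hja with haY
          · have haw : a ≠ w := ne_of_mem_erase (hYT haY)
            have := hlo w hw a ha haw.symm
            omega
          · exact absurd ⟨a, ha, hja⟩ h1
      · obtain ⟨Y, hYT, hYj⟩ := exists_subset_card_eq (by omega : j ≤ T.card)
        obtain ⟨a, ha, hja⟩ := hfail Y hYT hYj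
        split_ifs at hja
        · exact absurd ⟨a, ha, hja⟩ h2
        · exact absurd ⟨a, ha, hja⟩ h1
  have h1 : ((range (T.card + 1)).filter (fun j => σ + k * j ∈ B)).card ≤ B.card := by
    refine card_le_card_of_injOn (fun j => σ + k * j) (fun j hj => (mem_filter.1 hj).2) ?_
    intro a _ b _ hab
    exact Nat.eq_of_mul_eq_mul_left hk (Nat.add_left_cancel hab)
  have h2 : ((range (T.card + 1)).filter (fun j => ¬ σ + k * j ∈ B)).card ≤ D.card := by
    rcases T.eq_empty_or_nonempty with rfl | ⟨w₀, -⟩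
    · rw [card_eq_zero.2, card_eq_zero.2]
      · simp [hD]
      · refine filter_eq_empty_iff.2 fun j hj hjB => ?_
        obtain ⟨w, hw, -⟩ := key j hj hjB
        simp [hD] at hw
    · have : Nonempty ι := ⟨w₀⟩
      choose! g hg hg' using key
      -- One `w` cannot block both j = 0 and j = |T|: that would force k = k * |T|, against |T| ≥ 2.
      refine card_le_card_of_injOn g
        (fun j hj => hg j (mem_filter.1 hj).1 (mem_filter.1 hj).2) ?_
      intro a ha b hb hab
      have ha' := mem_filter.1 ha
      have hb' := mem_filter.1 hb
      have hT2 : 2 ≤ T.card := hT.resolve_right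
        (ne_empty_of_mem (hg a ha'.1 ha'.2))
      have hkT : k < k * T.card := by nlinarith
      have e1 := hg' a ha'.1 ha'.2
      have e2 := hg' b hb'.1 hb'.2
      rw [← hab] at e2
      rcases e1 with ⟨e1, e3⟩ | ⟨e1, e3⟩ <;> rcases e2 with ⟨e2, e4⟩ | ⟨e2, e4⟩
      · omega
      · have e5 : k * b = k * T.card := by rw [e2]
        omega
      · have e5 : k * a = k * T.card := by rw [e1]
        omega
      · omega
  have h3 := card_filter_add_card_filter_not (s := range (T.card + 1)) (fun j => σ + k * j ∈ B)
  rw [card_range] at h3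
  omega

/-- If `x` fails, its `e` values are exactly `α + x` and the elements of `B`. Comparing the sums of
both sides determines (e - 1) * x, so two different `x` cannot both fail. -/
theorem exists_shift_avoiding {k e α β x₁ x₂ : ℕ} (hk : 0 < k) (he : 2 ≤ e) {B : Finset ℕ}
    (hB : B.card + 1 ≤ e) (hx : x₁ ≠ x₂) :
    ∃ x, (x = x₁ ∨ x = x₂) ∧ ∃ j < e, β + x + k * j ∉ B ∧ β + x + k * j ≠ α + x := by
  by_contra! hcon
  have key : ∀ x, (x = x₁ ∨ x = x₂) →
      e * β + e * x + k * ∑ j ∈ range e, j = α + x + ∑ b ∈ B, b := by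
    intro x hx
    have hinj : Set.InjOn (fun j => β + x + k * j) (range e) := fun a _ b _ hab =>
      Nat.eq_of_mul_eq_mul_left hk (Nat.add_left_cancel hab)
    have hsub : (range e).image (fun j => β + x + k * j) ⊆ insert (α + x) B := by
      intro y hy
      obtain ⟨j, hj, rfl⟩ := mem_image.1 hy
      rw [mem_insert]
      by_contra! h
      exact h.1 (hcon x hx j (mem_range.1 hj) h.2)
    have hc : ((range e).image (fun j => β + x + k * j)).card = e := by
      rw [card_image_of_injOn hinj, card_range]
    have hc2 := card_insert_le (α + x) B
    have heq := eq_of_subset_of_card_le hsub (by omega)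
    have hnot : α + x ∉ B := by
      intro h
      rw [insert_eq_self.2 h] at heq
      rw [heq] at hc
      omega
    have hs := congrArg (fun s => ∑ y ∈ s, y) heq
    rw [sum_image hinj, sum_insert hnot, sum_add_distrib, ← mul_sum, sum_const, card_range,
      smul_eq_mul, mul_add] at hs
    exact hs
  have h1 := key x₁ (Or.inl rfl)
  have h2 := key x₂ (Or.inr rfl)
  obtain ⟨e, rfl⟩ : ∃ e', e = e' + 2 := ⟨e - 2, by omega⟩
  have h3 : (e + 1) * x₁ = (e + 1) * x₂ := by
    have h4 : (e + 2) * x₁ + x₂ = (e + 2) * x₂ + x₁ := by omega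
    nlinarith
  exact hx (Nat.eq_of_mul_eq_mul_left (by omega) h3)

theorem sum_card_filter_le {ι κ : Type*} [DecidableEq ι] [DecidableEq κ] (X : Finset ι) (F : Finset κ)
    (g : κ → ℕ) (h : ι → ℕ) (hh : Set.InjOn h X) :
    ∑ ρ ∈ X, (F.filter (fun f => g f = h ρ)).card ≤ F.card := by
  rw [← card_biUnion]
  · exact card_le_card (biUnion_subset.2 fun _ _ => filter_subset _ _)
  · intro a ha b hb hab
    rw [Function.onFun, disjoint_left]
    intro f h1 h2
    exact hab (hh ha hb ((mem_filter.1 h1).2.symm.trans (mem_filter.1 h2).2))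

/-- On average m/(d + 2) + n/e is less than 1, so some ρ has it below 1. Then n < e and m < d + 2;
if n = e - 1, moreover e * m < d + 2 ≤ 2e, whence m ≤ 1. -/
theorem exists_small_counts {ι : Type*} {X : Finset ι} {m n : ι → ℕ} {d e S : ℕ}
    (hde : d ≤ e) (he : 2 ≤ e) (hX : 2 * S ≤ X.card) (hS : d + e ≤ 2 * S)
    (hm : ∑ ρ ∈ X, m ρ + 3 ≤ d * S + d + e) (hn : ∑ ρ ∈ X, n ρ + 1 ≤ e * S) :
    ∃ ρ ∈ X, (m ρ ≤ d + 1 ∧ n ρ + 2 ≤ e) ∨ (m ρ ≤ 1 ∧ n ρ + 1 ≤ e) := by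
  obtain ⟨ρ, hρ, h⟩ : ∃ ρ ∈ X, e * m ρ + (d + 2) * n ρ < e * (d + 2) := by
    by_contra! hcon
    have h1 := card_nsmul_le_sum X _ _ hcon
    rw [sum_add_distrib, ← mul_sum, ← mul_sum, smul_eq_mul] at h1
    have h2 := Nat.mul_le_mul_right (e * (d + 2)) hX
    have h3 := Nat.mul_le_mul_left e hm
    have h4 := Nat.mul_le_mul_left (d + 2) hn
    have h5 := Nat.mul_le_mul_left e hS
    nlinarith
  refine ⟨ρ, hρ, ?_⟩
  have h1 : n ρ < e := by
    by_contra! hc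
    have := Nat.mul_le_mul_left (d + 2) hc
    nlinarith
  have h2 : m ρ < d + 2 := by
    by_contra! hc
    have := Nat.mul_le_mul_left e hc
    nlinarith
  rcases Nat.lt_or_ge (n ρ + 1) e with h3 | h3
  · exact Or.inl ⟨by omega, by omega⟩
  · refine Or.inr ⟨?_, by omega⟩
    have h4 : n ρ + 1 = e := by omega
    by_contra! hc
    have h5 := Nat.mul_le_mul_left e hc
    have h6 : (d + 2) * n ρ + (d + 2) = e * (d + 2) := by rw [← h4]; ring
    omega

/-! ### Completing the colouring at the last edge -/

/-- On the vertices of `C` the colouring `c` is a proper edge colouring with colours in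
`{1, …, K}` which distinguishes sums at distance at most `r`. -/
structure IsGoodOn (G : SimpleGraph V) [DecidableRel G.Adj] (r K : ℕ) (C : Finset V)
    (c : Sym2 V → ℕ) : Prop where
  range : ∀ p ∈ C, ∀ q, G.Adj p q → 1 ≤ c s(p, q) ∧ c s(p, q) ≤ K
  proper : ∀ x ∈ C, ∀ a b, a ≠ b → G.Adj x a → G.Adj x b → c s(x, a) ≠ c s(x, b)
  distinct : ∀ p ∈ C, ∀ q ∈ C, p ≠ q → G.edist p q ≤ r →
    weightedDegree G c p ≠ weightedDegree G c q

/-- All edges meeting `P ∪ {u, z}`, except for the edge `s(u, z)`, have been coloured. -/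
structure IsAlmostColouring (G : SimpleGraph V) [DecidableRel G.Adj] (r k : ℕ) (P : Finset V)
    (u z : V) (c : Sym2 V → ℕ) : Prop where
  partialColouring : IsPartialColouring G r k P c
  adj : G.Adj u z
  left_notMem : u ∉ P
  right_notMem : z ∉ P
  closed : ∀ p ∈ P, ∀ q, G.Adj p q → q ∈ P ∨ q = u ∨ q = z
  closed_left : ∀ q, G.Adj u q → q = z ∨ q ∈ P
  closed_right : ∀ q, G.Adj z q → q = u ∨ q ∈ P

section
variable {G : SimpleGraph V} [DecidableRel G.Adj] {r k : ℕ} {P : Finset V} {u z : V}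
  {c : Sym2 V → ℕ}

/-- The colouring `c` after the edge `s(u, z)` has received the colour `x` and the other edges
at `u` have been adjusted so that exactly the vertices of `Y` take their larger sums. -/
def completeLeft (G : SimpleGraph V) [DecidableRel G.Adj] (k : ℕ) (c : Sym2 V → ℕ) (u z : V)
    (x : ℕ) (Y : Finset V) : Sym2 V → ℕ :=
  reset G k c u ((G.neighborFinset u).erase z) Y fun _ => x

namespace IsAlmostColouring

theorem mem_left (h : IsAlmostColouring G r k P u z c)
    {w : V} : w ∈ (G.neighborFinset u).erase z ↔ G.Adj u w ∧ w ∈ P := by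
  rw [mem_erase, SimpleGraph.mem_neighborFinset]
  refine ⟨fun hw => ⟨hw.2, (h.closed_left w hw.2).resolve_left hw.1⟩, fun hw => ⟨?_, hw.1⟩⟩
  rintro rfl
  exact h.right_notMem hw.2

theorem mem_right (h : IsAlmostColouring G r k P u z c)
    {w : V} : w ∈ (G.neighborFinset z).erase u ↔ G.Adj z w ∧ w ∈ P := by
  rw [mem_erase, SimpleGraph.mem_neighborFinset]
  refine ⟨fun hw => ⟨hw.2, (h.closed_right w hw.2).resolve_left hw.1⟩, fun hw => ⟨?_, hw.1⟩⟩
  rintro rfl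
  exact h.left_notMem hw.2

theorem left_bounds (h : IsAlmostColouring G r k P u z c)
    : ∀ w ∈ (G.neighborFinset u).erase z, G.Adj u w ∧ k < c s(u, w) := by
  intro w hw
  have hw' := h.mem_left.1 hw
  rw [Sym2.eq_swap]
  exact ⟨hw'.1, (h.partialColouring.outer w hw'.2 u h.left_notMem hw'.1.symm).1⟩

theorem right_bounds (h : IsAlmostColouring G r k P u z c)
    : ∀ w ∈ (G.neighborFinset z).erase u, G.Adj z w ∧ k < c s(z, w) := by
  intro w hw
  have hw' := h.mem_right.1 hw
  rw [Sym2.eq_swap]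
  exact ⟨hw'.1, (h.partialColouring.outer w hw'.2 z h.right_notMem hw'.1.symm).1⟩

theorem ne_left (h : IsAlmostColouring G r k P u z c)
    {p : V} (hp : p ∈ P) : p ≠ u := fun e => h.left_notMem (e ▸ hp)

theorem ne_right (h : IsAlmostColouring G r k P u z c)
    {p : V} (hp : p ∈ P) : p ≠ z := fun e => h.right_notMem (e ▸ hp)

theorem completeLeft_edge (x : ℕ) (Y : Finset V) : completeLeft G k c u z x Y s(u, z) = x :=
  reset_left_of_notMem G c _ (by simp)

theorem completeLeft_right (h : IsAlmostColouring G r k P u z c)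
    (x : ℕ) (Y : Finset V) {w : V} (hw : w ≠ u) :
    completeLeft G k c u z x Y s(z, w) = c s(z, w) :=
  reset_of_ne G c _ h.adj.ne' hw

theorem weightedDegree_completeLeft_self (h : IsAlmostColouring G r k P u z c)
    (hk : 0 < k) (x : ℕ) {Y : Finset V}
    (hY : Y ⊆ (G.neighborFinset u).erase z) :
    weightedDegree G (completeLeft G k c u z x Y) u =
      baseSum G k c u ((G.neighborFinset u).erase z) + k * Y.card + x := by
  have h1 : G.neighborFinset u \ (G.neighborFinset u).erase z = {z} := by
    ext w
    simp only [mem_sdiff, mem_erase, SimpleGraph.mem_neighborFinset, mem_singleton]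
    constructor
    · tauto
    · rintro rfl
      exact ⟨h.adj, by tauto⟩
  rw [completeLeft, weightedDegree_reset_self G c _ hk h.left_bounds hY, h1, sum_singleton]

theorem weightedDegree_completeLeft_of_adj (h : IsAlmostColouring G r k P u z c)
    (hk : 0 < k) (x : ℕ) (Y : Finset V) {p : V}
    (hp : p ∈ P) (hadj : G.Adj u p) : weightedDegree G (completeLeft G k c u z x Y) p =
      low k (weightedDegree G c p) + if p ∈ Y then k else 0 := by
  have hpT := h.mem_left.2 ⟨hadj, hp⟩
  exact weightedDegree_reset_of_mem G c _ hk hadj hpT (h.left_bounds p hpT).2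

theorem weightedDegree_completeLeft_of_not_adj (h : IsAlmostColouring G r k P u z c)
    (x : ℕ) (Y : Finset V) {p : V}
    (hp : p ∈ P) (hadj : ¬ G.Adj u p) : weightedDegree G (completeLeft G k c u z x Y) p =
      weightedDegree G c p :=
  weightedDegree_reset_of_not_adj G c _ (h.ne_left hp) hadj

theorem low_weightedDegree_completeLeft (h : IsAlmostColouring G r k P u z c)
    (hk : 0 < k) (x : ℕ) (Y : Finset V) {p : V} (hp : p ∈ P) :
    low k (weightedDegree G (completeLeft G k c u z x Y) p) = low k (weightedDegree G c p) := by
  by_cases hadj : G.Adj u p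
  · rw [h.weightedDegree_completeLeft_of_adj hk x Y hp hadj]
    split_ifs
    · exact low_low_add hk _
    · exact low_low hk _
  · rw [h.weightedDegree_completeLeft_of_not_adj x Y hp hadj]

theorem weightedDegree_completeLeft_congr (h : IsAlmostColouring G r k P u z c)
    (hk : 0 < k) (x x' : ℕ) (Y : Finset V) {p : V}
    (hp : p ∈ P) : weightedDegree G (completeLeft G k c u z x Y) p =
      weightedDegree G (completeLeft G k c u z x' Y) p := by
  by_cases hadj : G.Adj u p
  · rw [h.weightedDegree_completeLeft_of_adj hk x Y hp hadj,
      h.weightedDegree_completeLeft_of_adj hk x' Y hp hadj]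
  · rw [h.weightedDegree_completeLeft_of_not_adj x Y hp hadj,
      h.weightedDegree_completeLeft_of_not_adj x' Y hp hadj]

theorem completeLeft_right_bounds (h : IsAlmostColouring G r k P u z c) (x : ℕ) (Y : Finset V) :
    ∀ w ∈ (G.neighborFinset z).erase u,
      G.Adj z w ∧ k < completeLeft G k c u z x Y s(z, w) := fun w hw => by
  rw [h.completeLeft_right x Y (ne_of_mem_erase hw)]
  exact h.right_bounds w hw

/-- It suffices to adjust the edges at `z` so that the sum of `z` avoids all other sums. -/
theorem exists_isGoodOn (h : IsAlmostColouring G r k P u z c)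
    (hk : 0 < k) {x : ℕ} (hx1 : 1 ≤ x) (hx3 : x ≤ 3 * k)
    (hxu : ∀ w ∈ (G.neighborFinset u).erase z, x % k ≠ c s(u, w) % k)
    (hxz : ∀ w ∈ (G.neighborFinset z).erase u, x % k ≠ c s(z, w) % k)
    {Y Z : Finset V} (hY : Y ⊆ (G.neighborFinset u).erase z)
    (hZ : Z ⊆ (G.neighborFinset z).erase u)
    (hu : ∀ p ∈ P, p ∈ punctured G r u →
      weightedDegree G (completeLeft G k c u z x Y) u ≠ weightedDegree G c p)
    (hu' : ∀ p ∈ P, G.Adj u p ∨ G.Adj z p →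
      weightedDegree G (completeLeft G k c u z x Y) u ≠ low k (weightedDegree G c p) ∧
      weightedDegree G (completeLeft G k c u z x Y) u ≠ low k (weightedDegree G c p) + k)
    {σ : ℕ} (hσ : σ = baseSum G k (completeLeft G k c u z x Y) z ((G.neighborFinset z).erase u) +
      x + k * Z.card)
    (hz : ∀ p ∈ P, p ∈ punctured G r z → ¬ G.Adj z p →
      σ ≠ weightedDegree G (completeLeft G k c u z x Y) p)
    (hz' : ∀ w ∈ (G.neighborFinset z).erase u,
      σ ≠ low k (weightedDegree G c w) + if w ∈ Z then k else 0)
    (huz : σ ≠ weightedDegree G (completeLeft G k c u z x Y) u) :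
    ∃ c', IsGoodOn G r (3 * k) (insert u (insert z P)) c' := by
  set c₁ := completeLeft G k c u z x Y with hc₁
  set Tz := (G.neighborFinset z).erase u with hTz
  set c₂ := reset G k c₁ z Tz Z fun w => c₁ s(z, w) with hc₂
  have hb := h.completeLeft_right_bounds x Y
  rw [← hc₁, ← hTz] at hb
  have huT : u ∉ Tz := by simp [hTz]
  have hself : weightedDegree G c₂ z = σ := by
    have h1 : G.neighborFinset z \ Tz = {u} := by
      ext w
      simp only [hTz, mem_sdiff, mem_erase, SimpleGraph.mem_neighborFinset, mem_singleton]
      constructor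
      · tauto
      · rintro rfl
        exact ⟨h.adj.symm, by tauto⟩
    rw [hc₂, weightedDegree_reset_self G c₁ _ hk hb hZ, h1, sum_singleton, Sym2.eq_swap,
      hc₁, completeLeft_edge, hσ]
    ring
  have hleft : weightedDegree G c₂ u = weightedDegree G c₁ u :=
    weightedDegree_reset_of_eq G c₁ _ h.adj.ne huT rfl
  have hPn : ∀ p ∈ P, ¬ G.Adj z p → weightedDegree G c₂ p = weightedDegree G c₁ p :=
    fun p hp hadj => weightedDegree_reset_of_not_adj G c₁ _ (h.ne_right hp) hadj
  have hPa : ∀ p ∈ Tz, weightedDegree G c₂ p =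
      low k (weightedDegree G c p) + if p ∈ Z then k else 0 := fun p hp => by
    rw [hc₂, weightedDegree_reset_of_mem G c₁ _ hk (hb p hp).1 hp (hb p hp).2, hc₁,
      h.low_weightedDegree_completeLeft hk x Y (h.mem_right.1 hp).2]
  have hlow : ∀ p ∈ P, low k (weightedDegree G c₂ p) = low k (weightedDegree G c p) := by
    intro p hp
    rw [← h.low_weightedDegree_completeLeft hk x Y hp, ← hc₁]
    by_cases hadj : G.Adj z p
    · have hpT : p ∈ Tz := h.mem_right.2 ⟨hadj, hp⟩
      exact low_weightedDegree_reset G c₁ _ hk hadj hpT (hb p hpT).2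
    · rw [hPn p hp hadj]
  have hmodu : ∀ w, G.Adj u w → w ≠ z → c₁ s(u, w) % k = c s(u, w) % k := fun w hw hwz => by
    have hwT : w ∈ (G.neighborFinset u).erase z := by simp [hw, hwz]
    exact reset_left_mod G c _ hk hwT (h.left_bounds w hwT).2
  have hmodz : ∀ w, G.Adj z w → w ≠ u → c₂ s(z, w) % k = c s(z, w) % k := fun w hw hwu => by
    have hwT : w ∈ Tz := by simp [hTz, hw, hwu]
    rw [hc₂, reset_left_mod G c₁ _ hk hwT (hb w hwT).2, hc₁, h.completeLeft_right x Y hwu]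
  have hoff : ∀ a b, a ≠ z → b ≠ z → c₂ s(a, b) = c₁ s(a, b) := fun a b ha hb =>
    reset_of_ne G c₁ _ ha hb
  have hoff' : ∀ a b, a ≠ u → b ≠ u → c₁ s(a, b) = c s(a, b) := fun a b ha hb =>
    reset_of_ne G c _ ha hb
  have hedge : c₂ s(u, z) = x := by
    rw [Sym2.eq_swap, hc₂, reset_left_of_notMem G c₁ _ huT, Sym2.eq_swap, hc₁, completeLeft_edge]
  have hmod : ∀ a b, G.Adj a b → s(a, b) ≠ s(u, z) → c₂ s(a, b) % k = c s(a, b) % k := by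
    intro a b hab hne
    have hne1 : ¬ (a = u ∧ b = z) := fun e => hne (by rw [e.1, e.2])
    have hne2 : ¬ (a = z ∧ b = u) := fun e => hne (by rw [e.1, e.2, Sym2.eq_swap])
    by_cases haz : a = z
    · subst haz
      exact hmodz b hab (by tauto)
    by_cases hbz : b = z
    · subst hbz
      rw [Sym2.eq_swap]
      exact hmodz a hab.symm (by tauto)
    rw [hoff a b haz hbz]
    by_cases hau : a = u
    · subst hau
      exact hmodu b hab hbz
    by_cases hbu : b = u
    · subst hbu
      rw [Sym2.eq_swap]
      exact hmodu a hab.symm haz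
    rw [hoff' a b hau hbu]
  have hrangez : ∀ w, G.Adj z w → 1 ≤ c₂ s(z, w) ∧ c₂ s(z, w) ≤ 3 * k := by
    intro w hw
    by_cases hwu : w = u
    · subst hwu
      rw [Sym2.eq_swap, hedge]
      exact ⟨hx1, hx3⟩
    · have hwT : w ∈ Tz := by simp [hTz, hw, hwu]
      refine reset_left_bounds G c₁ _ hk hwT (hb w hwT).2 ?_
      have hwP := (h.mem_right.1 hwT).2
      rw [hc₁, h.completeLeft_right x Y hwu, Sym2.eq_swap]
      exact (h.partialColouring.outer w hwP z h.right_notMem hw.symm).2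
  have hrangeu : ∀ w, G.Adj u w → 1 ≤ c₂ s(u, w) ∧ c₂ s(u, w) ≤ 3 * k := by
    intro w hw
    by_cases hwz : w = z
    · subst hwz
      rw [hedge]
      exact ⟨hx1, hx3⟩
    · have hwT : w ∈ (G.neighborFinset u).erase z := by simp [hw, hwz]
      have hwP := (h.mem_left.1 hwT).2
      rw [hoff u w h.adj.ne hwz]
      refine reset_left_bounds G c _ hk hwT (h.left_bounds w hwT).2 ?_
      rw [Sym2.eq_swap]
      exact (h.partialColouring.outer w hwP u h.left_notMem hw.symm).2
  have huP : ∀ p ∈ P, G.edist u p ≤ r → weightedDegree G c₂ u ≠ weightedDegree G c₂ p := by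
    intro p hp hd
    rw [hleft]
    -- The resets can move neighbours of `u` or `z` within their pairs, so the sum of `u` avoids
    -- both members; all other vertices keep their sums.
    by_cases hadj : G.Adj u p ∨ G.Adj z p
    · have h1 := hu' p hp hadj
      have h2 := low_cases hk (weightedDegree G c₂ p)
      rw [hlow p hp] at h2
      intro h3
      rcases h2 with h2 | h2
      · exact h1.1 (h3.trans h2)
      · exact h1.2 (h3.trans h2)
    · rw [not_or] at hadj
      rw [hPn p hp hadj.2, hc₁, h.weightedDegree_completeLeft_of_not_adj x Y hp hadj.1]
      exact hu p hp (mem_punctured.2 ⟨h.ne_left hp, hd⟩)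
  have hzP : ∀ p ∈ P, G.edist z p ≤ r → weightedDegree G c₂ z ≠ weightedDegree G c₂ p := by
    intro p hp hd
    rw [hself]
    by_cases hadj : G.Adj z p
    · have hpT : p ∈ Tz := h.mem_right.2 ⟨hadj, hp⟩
      rw [hPa p hpT]
      exact hz' p hpT
    · rw [hPn p hp hadj]
      exact hz p hp (mem_punctured.2 ⟨h.ne_right hp, hd⟩) hadj
  refine ⟨c₂, ?_, ?_, ?_⟩
  · intro p hp q hadj
    by_cases hpu : p = u
    · exact hpu ▸ hrangeu q (hpu ▸ hadj)
    by_cases hpz : p = z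
    · exact hpz ▸ hrangez q (hpz ▸ hadj)
    have hpP : p ∈ P := by simpa [hpu, hpz] using hp
    rcases h.closed p hpP q hadj with hq | rfl | rfl
    · rw [hoff p q hpz (h.ne_right hq), hoff' p q hpu (h.ne_left hq)]
      exact h.partialColouring.inner p hpP q hq hadj
    · rw [Sym2.eq_swap]
      exact hrangeu p hadj.symm
    · rw [Sym2.eq_swap]
      exact hrangez p hadj.symm
  · intro y hy a b hab hya hyb heq
    have heq' := congrArg (· % k) heq
    have hcross : ∀ b, G.Adj u b → b ≠ z → c₂ s(u, b) % k ≠ x % k := fun b hb hbz => by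
      rw [hmod u b hb (fun e => hbz (Sym2.congr_right.1 e))]
      exact (hxu b (by simp [hb, hbz])).symm
    have hcross' : ∀ b, G.Adj z b → b ≠ u → c₂ s(z, b) % k ≠ x % k := fun b hb hbu => by
      rw [hmodz b hb hbu]
      exact (hxz b (by simp [hTz, hb, hbu])).symm
    have hedge' : c₂ s(z, u) = x := by rw [Sym2.eq_swap, hedge]
    have haux : ∀ a b, a ≠ b → G.Adj y a → G.Adj y b → s(y, a) = s(u, z) →
        c₂ s(y, a) % k ≠ c₂ s(y, b) % k := by
      intro a b hab hya hyb hs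
      rcases Sym2.eq_iff.1 hs with ⟨rfl, rfl⟩ | ⟨rfl, rfl⟩
      · rw [hedge]
        exact (hcross b hyb hab.symm).symm
      · rw [hedge']
        exact (hcross' b hyb hab.symm).symm
    by_cases hsa : s(y, a) = s(u, z)
    · exact haux a b hab hya hyb hsa heq'
    by_cases hsb : s(y, b) = s(u, z)
    · exact haux b a hab.symm hyb hya hsb heq'.symm
    rw [hmod y a hya hsa, hmod y b hyb hsb] at heq'
    have hmem : ∀ a, G.Adj y a → s(y, a) ≠ s(u, z) → y ∈ P ∨ a ∈ P := by
      intro a hya hsa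
      by_cases hyu : y = u
      · subst hyu
        exact Or.inr ((h.closed_left a hya).resolve_left fun e => hsa (by rw [e]))
      by_cases hyz : y = z
      · subst hyz
        exact Or.inr ((h.closed_right a hya).resolve_left fun e => hsa (by rw [e, Sym2.eq_swap]))
      · exact Or.inl (by simpa [hyu, hyz] using hy)
    exact h.partialColouring.proper y a b hab hya hyb (hmem a hya hsa) (hmem b hyb hsb) heq'
  · have hzu : weightedDegree G c₂ z ≠ weightedDegree G c₂ u := by
      rw [hself, hleft]
      exact huz
    have hPP : ∀ p ∈ P, ∀ q ∈ P, p ≠ q → G.edist p q ≤ r →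
        weightedDegree G c₂ p ≠ weightedDegree G c₂ q := by
      intro p hp q hq hpq hd heq
      refine h.partialColouring.distinct p hp q hq hpq hd ?_
      rw [← hlow p hp, ← hlow q hq, heq]
    intro p hp q hq hpq hd
    have hd' : G.edist q p ≤ r := by rwa [SimpleGraph.edist_comm]
    rw [mem_insert, mem_insert] at hp hq
    rcases hp with hp | hp | hp <;> rcases hq with hq | hq | hq
    · exact absurd (hp.trans hq.symm) hpq
    · rw [hp, hq]
      exact hzu.symm
    · rw [hp]
      exact huP q hq (hp ▸ hd)
    · rw [hp, hq]
      exact hzu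
    · exact absurd (hp.trans hq.symm) hpq
    · rw [hp]
      exact hzP q hq (hp ▸ hd)
    · rw [hq]
      exact (huP p hp (hq ▸ hd')).symm
    · rw [hq]
      exact (hzP p hp (hq ▸ hd')).symm
    · exact hPP p hp q hq hpq hd

end IsAlmostColouring
end

/-- Let d ≤ e be the degrees of `u` and `z`. For a residue ρ the sum of `u` takes d + 2 values (a ≤
2 and d - 1 shifts), that of `z` takes e values once `a` is fixed. Either outcome of
`exists_small_counts` leaves room for both, the second only after exploiting two free values of `a`.
-/
theorem IsAlmostColouring.exists_completion {G : SimpleGraph V} [DecidableRel G.Adj]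
    {Δ r S k : ℕ} {P : Finset V} {u z : V} {c : Sym2 V → ℕ} (h : IsAlmostColouring G r k P u z c)
    (hr : 2 ≤ r) (hΔ : ∀ v, G.degree v ≤ Δ)
    (hS : ∀ v, (punctured G r v).card ≤ G.degree v * S) (hΔS : Δ ≤ S)
    (hk : k + 2 = 2 * S + 2 * Δ) (hde : G.degree u ≤ G.degree z) (he : 2 ≤ G.degree z) :
    ∃ c', IsGoodOn G r (3 * k) (insert u (insert z P)) c' := by
  have hk0 : 0 < k := by
    have := hΔ z
    omega
  set Tu := (G.neighborFinset u).erase z with hTu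
  set Tz := (G.neighborFinset z).erase u with hTz
  have hTuc : Tu.card + 1 = G.degree u := by
    rw [hTu, ← SimpleGraph.card_neighborFinset_eq_degree]
    exact card_erase_add_one (by simpa using h.adj)
  have hTzc : Tz.card + 1 = G.degree z := by
    rw [hTz, ← SimpleGraph.card_neighborFinset_eq_degree]
    exact card_erase_add_one (by simpa using h.adj.symm)
  have hTuP : ∀ w ∈ Tu, w ∈ P := fun w hw => (h.mem_left.1 hw).2
  have hTzP : ∀ w ∈ Tz, w ∈ P := fun w hw => (h.mem_right.1 hw).2
  -- the values that the sum of `u` has to avoid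
  set P' := punctured G r u ∩ P with hP'
  have hNP' : Tu ∪ Tz ⊆ P' := by
    intro w hw
    rcases mem_union.1 hw with hw | hw
    · exact mem_inter.2 ⟨adj_mem_punctured (by omega) (h.mem_left.1 hw).1, hTuP w hw⟩
    · exact mem_inter.2 ⟨mem_punctured.2 ⟨h.ne_left (hTzP w hw),
        edist_le_two hr h.adj.symm (h.mem_right.1 hw).1⟩, hTzP w hw⟩
  set Fu := (P' \ (Tu ∪ Tz)).image (weightedDegree G c) ∪ (Tu ∪ Tz).biUnion fun p =>
    {low k (weightedDegree G c p), low k (weightedDegree G c p) + k} with hFu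
  -- Each of the at most (d - 1) + (e - 1) neighbours counts twice; `z` lies in the ball but not in
  -- `P`, which saves one.
  have hFuc : Fu.card + 3 ≤ G.degree u * S + G.degree u + G.degree z := by
    have h1 : Fu.card ≤ (P' \ (Tu ∪ Tz)).card + (Tu ∪ Tz).card * 2 :=
      (card_union_le _ _).trans (Nat.add_le_add card_image_le
        (card_biUnion_le_card_mul _ _ _ fun _ _ => card_le_two))
    have h2 := card_sdiff_add_card_eq_card hNP'
    have h3 := card_union_le Tu Tz
    have h4 : P'.card < (punctured G r u).card := card_lt_card
      ⟨inter_subset_left, fun hsub => h.right_notMem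
        (mem_inter.1 (hsub (adj_mem_punctured (by omega) h.adj))).2⟩
    have h5 := hS u
    omega
  have hFu1 : ∀ p ∈ P, p ∈ punctured G r u → weightedDegree G c p ∈ Fu := by
    intro p hp hpu
    by_cases hpT : p ∈ Tu ∪ Tz
    · refine mem_union_right _ (mem_biUnion.2 ⟨p, hpT, ?_⟩)
      rw [mem_insert, mem_singleton]
      exact low_cases hk0 _
    · exact mem_union_left _ (mem_image_of_mem _ (mem_sdiff.2 ⟨mem_inter.2 ⟨hpu, hp⟩, hpT⟩))
  have hFu2 : ∀ p ∈ Tu ∪ Tz, low k (weightedDegree G c p) ∈ Fu ∧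
      low k (weightedDegree G c p) + k ∈ Fu := fun p hp =>
    ⟨mem_union_right _ (mem_biUnion.2 ⟨p, hp, by simp⟩),
      mem_union_right _ (mem_biUnion.2 ⟨p, hp, by simp⟩)⟩
  set Qz := punctured G r z ∩ P with hQz
  have hQzc : Qz.card + 1 ≤ G.degree z * S := by
    have h4 : Qz.card < (punctured G r z).card := card_lt_card
      ⟨inter_subset_left, fun hsub => h.left_notMem
        (mem_inter.1 (hsub (adj_mem_punctured (by omega) h.adj.symm))).2⟩
    have h5 := hS z
    omega
  -- the residues available for the edge between `u` and `z`
  set R := Tu.image (fun w => c s(u, w) % k) ∪ Tz.image (fun w => c s(z, w) % k) with hR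
  set X := (Icc (0 + 1) (0 + k)).filter (fun x => x % k ∉ R) with hX
  have hXc : 2 * S ≤ X.card := by
    have h1 : k ≤ X.card + R.card := card_filter_mod_notMem 0 k R
    have h2 : R.card ≤ Tu.card + Tz.card :=
      (card_union_le _ _).trans (Nat.add_le_add card_image_le card_image_le)
    have := hΔ u
    have := hΔ z
    omega
  have hinj : ∀ a, Set.InjOn (fun ρ => (a + ρ) % k) X := fun a x hx y hy hxy =>
    mod_inj_of_mem_Icc (mem_filter.1 hx).1 (mem_filter.1 hy).1 (Nat.ModEq.add_left_cancel' a hxy)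
  set α := baseSum G k c u Tu with hα
  set γ := ∑ w ∈ Tz, c s(z, w) with hγ
  obtain ⟨ρ, hρX, hρ⟩ := exists_small_counts hde he hXc
    (by have := hΔ u; have := hΔ z; omega)
    ((Nat.add_le_add_right (sum_card_filter_le X Fu (fun f => f % k) _ (hinj α)) 3).trans hFuc)
    ((Nat.add_le_add_right
      (sum_card_filter_le X Qz (fun q => weightedDegree G c q % k) _ (hinj γ)) 1).trans hQzc)
  set Fρ := Fu.filter (fun f => f % k = (α + ρ) % k) with hFρ
  set Q := Qz.filter (fun q => weightedDegree G c q % k = (γ + ρ) % k) with hQ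
  have hρ' := mem_filter.1 hρX
  rw [mem_Icc] at hρ'
  have hmodu : ∀ j, (α + ρ + k * j) % k = (α + ρ) % k := fun j => Nat.add_mul_mod_self_left _ _ _
  set σ : ℕ → Finset V → ℕ := fun a Y =>
    baseSum G k (completeLeft G k c u z (ρ + k * a) Y) z Tz + (ρ + k * a) with hσ
  have hσmod : ∀ a Y j, (σ a Y + k * j) % k = (γ + ρ) % k := by
    intro a Y j
    have h1 := baseSum_mod G (completeLeft G k c u z (ρ + k * a) Y) hk0
      (fun w hw => (h.completeLeft_right_bounds (ρ + k * a) Y w hw).2)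
    have h2 : ∑ w ∈ Tz, completeLeft G k c u z (ρ + k * a) Y s(z, w) = γ :=
      sum_congr rfl fun w hw => h.completeLeft_right _ _ (ne_of_mem_erase hw)
    rw [← hTz, h2] at h1
    rw [Nat.add_mul_mod_self_left, hσ]
    simp only
    rw [← add_assoc, Nat.add_mul_mod_self_left, Nat.add_mod, h1, ← Nat.add_mod]
  have hself : ∀ a, ∀ Y ⊆ Tu, weightedDegree G (completeLeft G k c u z (ρ + k * a) Y) u =
      α + ρ + k * (a + Y.card) := fun a Y hY => by
    rw [h.weightedDegree_completeLeft_self hk0 _ hY]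
    ring
  have hwdmod : ∀ a Y, ∀ p ∈ P,
      weightedDegree G (completeLeft G k c u z (ρ + k * a) Y) p % k = weightedDegree G c p % k := by
    intro a Y p hp
    rw [← low_mod, h.low_weightedDegree_completeLeft hk0 _ Y hp, low_mod]
  have hlomod : ∀ (w : V) (Z : Finset V),
      (low k (weightedDegree G c w) + if w ∈ Z then k else 0) % k = weightedDegree G c w % k := by
    intro w Z
    split_ifs
    · rw [Nat.add_mod_right, low_mod]
    · rw [add_zero, low_mod]
  have hfin : ∀ a ≤ 2, ∀ Y ⊆ Tu, α + ρ + k * (a + Y.card) ∉ Fu → ∀ Z ⊆ Tz,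
      (∀ q ∈ Q \ Tz, σ a Y + k * Z.card ≠
        weightedDegree G (completeLeft G k c u z (ρ + k * a) Y) q) →
      (∀ w ∈ Tz, weightedDegree G c w % k = (γ + ρ) % k →
        σ a Y + k * Z.card ≠ low k (weightedDegree G c w) + if w ∈ Z then k else 0) →
      σ a Y + k * Z.card ≠ α + ρ + k * (a + Y.card) →
      ∃ c', IsGoodOn G r (3 * k) (insert u (insert z P)) c' := by
    intro a ha Y hY haF Z hZ hq hw hne
    have hka : k * a ≤ k * 2 := Nat.mul_le_mul_left k ha
    have hmod : (ρ + k * a) % k ∉ R := by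
      rw [Nat.add_mul_mod_self_left]
      exact hρ'.2
    rw [← hself a Y hY] at haF hne
    refine h.exists_isGoodOn hk0 (by omega) (by omega) ?_ ?_ hY hZ ?_ ?_ (σ := σ a Y + k * Z.card)
      rfl ?_ ?_ hne
    · intro w hw heq
      exact hmod (mem_union_left _ (mem_image.2 ⟨w, hw, heq.symm⟩))
    · intro w hw heq
      exact hmod (mem_union_right _ (mem_image.2 ⟨w, hw, heq.symm⟩))
    · intro p hp hpu heq
      exact haF (heq ▸ hFu1 p hp hpu)
    · intro p hp hor
      have hpT : p ∈ Tu ∪ Tz := by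
        rcases hor with hor | hor
        · exact mem_union_left _ (h.mem_left.2 ⟨hor, hp⟩)
        · exact mem_union_right _ (h.mem_right.2 ⟨hor, hp⟩)
      exact ⟨fun heq => haF (heq ▸ (hFu2 p hpT).1), fun heq => haF (heq ▸ (hFu2 p hpT).2)⟩
    · intro p hp hpz hadj heq
      refine hq p (mem_sdiff.2 ⟨mem_filter.2 ⟨mem_inter.2 ⟨hpz, hp⟩, ?_⟩,
        fun hpT => hadj (h.mem_right.1 hpT).1⟩) heq
      rw [← hwdmod a Y p hp, ← heq, hσmod]
    · intro w hwT heq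
      refine hw w hwT ?_ heq
      rw [← hlomod w Z, ← heq, hσmod]
  set Tc := Tz.filter (fun w => low k (weightedDegree G c w) % k = (γ + ρ) % k) with hTc
  have hTcQ : (Q \ Tz).card + Tc.card ≤ Q.card := by
    rw [← card_union_of_disjoint]
    · refine card_le_card (union_subset sdiff_subset fun w hw => ?_)
      have hw' := mem_filter.1 hw
      refine mem_filter.2 ⟨mem_inter.2 ⟨adj_mem_punctured (by omega) (h.mem_right.1 hw'.1).1,
        hTzP w hw'.1⟩, ?_⟩
      rw [← low_mod, hw'.2]
    · rw [disjoint_left]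
      intro w h1 h2
      exact (mem_sdiff.1 h1).2 (mem_filter.1 h2).1
  have hlo : ∀ a ∈ Tz, ∀ b ∈ Tz, a ≠ b →
      low k (weightedDegree G c a) ≠ low k (weightedDegree G c b) ∧
      low k (weightedDegree G c a) ≠ low k (weightedDegree G c b) + k := by
    intro a ha b hb hab
    have h1 := h.partialColouring.distinct a (hTzP a ha) b (hTzP b hb) hab
      (edist_le_two hr (h.mem_right.1 ha).1 (h.mem_right.1 hb).1)
    refine ⟨h1, fun h2 => h1 ?_⟩
    have h3 := congrArg (low k) h2
    rwa [low_low hk0, low_low_add hk0] at h3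
  have hTcσ : ∀ a Y, Tz.filter (fun w => low k (weightedDegree G c w) % k = σ a Y % k) = Tc := by
    intro a Y
    have := hσmod a Y 0
    rw [mul_zero, add_zero] at this
    rw [this]
  rcases hρ with ⟨hm, hn⟩ | ⟨hm, hn⟩
  · obtain ⟨i, hi, hiF⟩ : ∃ i < G.degree u + 2, α + ρ + k * i ∉ Fu := by
      by_contra! hcon
      have h1 : (range (G.degree u + 2)).card ≤ Fρ.card := by
        refine card_le_card_of_injOn (fun i => α + ρ + k * i) ?_ ?_
        · intro i hi
          exact mem_filter.2 ⟨hcon i (mem_range.1 hi), hmodu i⟩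
        · intro a _ b _ hab
          exact Nat.eq_of_mul_eq_mul_left hk0 (Nat.add_left_cancel hab)
      rw [card_range] at h1
      omega
    -- The multiple i ≤ d + 1 is split into a = min i 2, put on the edge `s(u, z)`, and at most d -
    -- 1 shifts.
    obtain ⟨Y, hY, hYc⟩ := exists_subset_card_eq (by omega : i - min i 2 ≤ Tu.card)
    have hia : min i 2 + Y.card = i := by omega
    set a := min i 2 with ha
    obtain ⟨Z, hZ, hZB, hZT⟩ := exists_subset_avoiding (T := Tz) (σ := σ a Y) hk0 hlo
      (insert (α + ρ + k * i) ((Q \ Tz).image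
        (weightedDegree G (completeLeft G k c u z (ρ + k * a) Y))))
      -- One unit goes to the sum of `u`; the rest is at most e - 2.
      (by
        rw [hTcσ]
        have h1 := card_insert_le (α + ρ + k * i) ((Q \ Tz).image
          (weightedDegree G (completeLeft G k c u z (ρ + k * a) Y)))
        have h2 : ((Q \ Tz).image (weightedDegree G
          (completeLeft G k c u z (ρ + k * a) Y))).card ≤ (Q \ Tz).card := card_image_le
        omega)
      (by
        rw [hTcσ]
        rcases Nat.lt_or_ge Tz.card 2 with h1 | h1
        · right
          rw [← card_eq_zero]
          omega
        · exact Or.inl h1)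
    rw [mem_insert, not_or] at hZB
    refine hfin a (by omega) Y hY (by rwa [hia]) Z hZ ?_ (fun w hw _ => hZT w hw)
      (by rw [hia]; exact hZB.1)
    intro q hq heq
    exact hZB.2 (heq ▸ mem_image_of_mem _ hq)
  -- At most one value is blocked at `u`, so with `Y` empty two of a = 0, 1, 2 are free.
  · have hpair : ∀ i j, i ≠ j → α + ρ + k * i ∈ Fu → α + ρ + k * j ∉ Fu := by
      intro i j hij hi hj
      have h1 := card_le_one.1 hm _ (mem_filter.2 ⟨hi, hmodu i⟩) _ (mem_filter.2 ⟨hj, hmodu j⟩)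
      exact hij (Nat.eq_of_mul_eq_mul_left hk0 (Nat.add_left_cancel h1))
    obtain ⟨i, j, hi2, hj2, hij, hi, hj⟩ : ∃ i j, i ≤ 2 ∧ j ≤ 2 ∧ i ≠ j ∧
        α + ρ + k * i ∉ Fu ∧ α + ρ + k * j ∉ Fu := by
      by_cases h0 : α + ρ + k * 0 ∈ Fu
      · exact ⟨1, 2, by omega, by omega, by omega, hpair 0 1 (by omega) h0,
          hpair 0 2 (by omega) h0⟩
      · by_cases h1 : α + ρ + k * 1 ∈ Fu
        · exact ⟨0, 2, by omega, by omega, by omega, h0, hpair 1 2 (by omega) h1⟩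
        · exact ⟨0, 1, by omega, by omega, by omega, h0, h1⟩
    have hgood : ∀ a, a = i ∨ a = j → a ≤ 2 ∧ α + ρ + k * (a + (∅ : Finset V).card) ∉ Fu := by
      rintro a (rfl | rfl) <;> simpa using ⟨by assumption, by assumption⟩
    set w₀ := weightedDegree G (completeLeft G k c u z (ρ + k * 0) ∅) with hw₀
    have hwc : ∀ a, ∀ p ∈ P,
        weightedDegree G (completeLeft G k c u z (ρ + k * a) ∅) p = w₀ p := fun a p hp =>
      h.weightedDegree_completeLeft_congr hk0 _ _ ∅ hp
    set β := baseSum G k (completeLeft G k c u z (ρ + k * 0) ∅) z Tz with hβ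
    have hσβ : ∀ a, σ a ∅ = β + (ρ + k * a) := by
      intro a
      rw [hσ, hβ]
      simp only [baseSum]
      congr 1
      refine sum_congr rfl fun w hw => ?_
      rw [hwc a w (hTzP w hw), ← hw₀, h.completeLeft_right _ _ (ne_of_mem_erase hw),
        h.completeLeft_right _ _ (ne_of_mem_erase hw)]
    have hQP : ∀ q ∈ Q, q ∈ P := fun q hq => (mem_inter.1 (mem_filter.1 hq).1).2
    by_cases hsame : (α + ρ) % k = (γ + ρ) % k
    -- A neighbour of `z` in this residue class would put both members of its pair into `Fu`,
    -- against the bound 1.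
    · have hTzQ : ∀ w ∈ Tz, weightedDegree G c w % k ≠ (γ + ρ) % k := by
        intro w hw heq
        rw [← hsame, ← low_mod] at heq
        have h1 := hFu2 w (mem_union_right _ hw)
        have h2 := card_le_one.1 hm _ (mem_filter.2 ⟨h1.1, heq⟩) _
          (mem_filter.2 ⟨h1.2, by rw [Nat.add_mod_right, heq]⟩)
        omega
      have hxne : ρ + k * i ≠ ρ + k * j := fun heq =>
        hij (Nat.eq_of_mul_eq_mul_left hk0 (Nat.add_left_cancel heq))
      obtain ⟨x, hx, m, hm', hmB, hmu⟩ := exists_shift_avoiding (α := α) (β := β) hk0 he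
        (B := Q.image w₀) ((Nat.add_le_add_right card_image_le 1).trans hn) hxne
      obtain ⟨a, hax, hai⟩ : ∃ a, x = ρ + k * a ∧ (a = i ∨ a = j) := by
        rcases hx with hx | hx
        · exact ⟨i, hx, Or.inl rfl⟩
        · exact ⟨j, hx, Or.inr rfl⟩
      obtain ⟨Z, hZ, rfl⟩ := exists_subset_card_eq (by omega : m ≤ Tz.card)
      rw [hax, ← hσβ] at hmB hmu
      refine hfin a (hgood a hai).1 ∅ (empty_subset _) (hgood a hai).2 Z hZ ?_
        (fun w hw hmod => absurd hmod (hTzQ w hw)) ?_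
      · intro q hq heq
        have hqQ := (mem_sdiff.1 hq).1
        rw [hwc a q (hQP q hqQ)] at heq
        exact hmB (heq ▸ mem_image_of_mem _ hqQ)
      · rw [card_empty, add_zero, add_assoc α]
        exact hmu
    · have hne : ∀ a j l, σ a ∅ + k * j ≠ α + ρ + k * l := by
        intro a j l heq
        have h1 := hσmod a ∅ j
        rw [heq, hmodu] at h1
        exact hsame h1
      by_cases hcase : 2 ≤ Tz.card ∨ Tc = ∅
      · obtain ⟨Z, hZ, hZB, hZT⟩ := exists_subset_avoiding (T := Tz) (σ := σ i ∅) hk0 hlo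
          ((Q \ Tz).image w₀)
          (by
            rw [hTcσ]
            have h2 : ((Q \ Tz).image w₀).card ≤ (Q \ Tz).card := card_image_le
            omega)
          (by rwa [hTcσ])
        refine hfin i hi2 ∅ (empty_subset _) (hgood i (Or.inl rfl)).2 Z hZ ?_
          (fun w hw _ => hZT w hw) (hne _ _ _)
        intro q hq heq
        rw [hwc i q (hQP q (mem_sdiff.1 hq).1)] at heq
        exact hZB (heq ▸ mem_image_of_mem _ hq)
      -- Here e = 2 and the single other neighbour `w` of `z` is the only obstruction. With no shift
      -- at `z`, one of the two free values of `a` avoids the smaller sum of `w`.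
      · rw [not_or] at hcase
        have hTc1 : 1 ≤ Tc.card := card_pos.2 (nonempty_iff_ne_empty.2 hcase.2)
        have hQT : Q \ Tz = ∅ := by
          rw [← card_eq_zero]
          omega
        obtain ⟨w, hw⟩ := card_eq_one.1 (by omega : Tz.card = 1)
        obtain ⟨a, ha, haw⟩ : ∃ a, (a = i ∨ a = j) ∧ σ a ∅ ≠ low k (weightedDegree G c w) := by
          by_contra! hcon
          have h1 := hcon i (Or.inl rfl)
          have h2 := hcon j (Or.inr rfl)
          rw [hσβ] at h1 h2
          exact hij (Nat.eq_of_mul_eq_mul_left hk0 (by omega))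
        refine hfin a (hgood a ha).1 ∅ (empty_subset _) (hgood a ha).2 ∅ (empty_subset _) ?_ ?_
          (hne _ _ _)
        · rw [hQT]
          simp
        · intro w' hw' _
          rw [hw, mem_singleton] at hw'
          rw [hw']
          simpa using haw

/-! ### Components -/

/-- The vertices of a connected component. -/
noncomputable def componentFinset (G : SimpleGraph V) (K : G.ConnectedComponent) : Finset V := by
  classical exact univ.filter (fun v => G.connectedComponentMk v = K)

theorem mem_componentFinset {G : SimpleGraph V} {K : G.ConnectedComponent} {v : V} :
    v ∈ componentFinset G K ↔ G.connectedComponentMk v = K := by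
  simp [componentFinset]

theorem mem_componentFinset_of_adj {G : SimpleGraph V} {K : G.ConnectedComponent} {v w : V}
    (hv : v ∈ componentFinset G K) (h : G.Adj v w) : w ∈ componentFinset G K := by
  rw [mem_componentFinset] at hv ⊢
  rw [← hv, SimpleGraph.ConnectedComponent.eq]
  exact h.symm.reachable

theorem exists_isGoodOn_componentFinset (G : SimpleGraph V) [DecidableRel G.Adj] {Δ r S k : ℕ}
    (hr : 2 ≤ r) (hG : NoIsolatedEdges G) (hΔ : ∀ v, G.degree v ≤ Δ)
    (hS : ∀ v, (punctured G r v).card ≤ G.degree v * S) (hS1 : 1 ≤ S) (hΔS : Δ ≤ S)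
    (hk : k + 2 = 2 * S + 2 * Δ) (K : G.ConnectedComponent) :
    ∃ c, IsGoodOn G r (3 * k) (componentFinset G K) c := by
  obtain ⟨v₀, hv₀⟩ := K.exists_rep
  obtain ⟨z, hz, hmax⟩ := exists_max_image (componentFinset G K)
    (fun v => G.degree v) ⟨v₀, mem_componentFinset.2 hv₀⟩
  rcases Nat.eq_zero_or_pos (G.degree z) with h0 | hpos
  · have hno : ∀ p ∈ componentFinset G K, ∀ q, ¬ G.Adj p q := by
      intro p hp q hadj
      have h1 := hmax p hp
      have h2 : 0 < G.degree p := by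
        rw [← SimpleGraph.card_neighborFinset_eq_degree]
        exact card_pos.2 ⟨q, by simpa using hadj⟩
      omega
    refine ⟨fun _ => 0, fun p hp q hadj => absurd hadj (hno p hp q),
      fun p hp q _ _ hadj _ => absurd hadj (hno p hp q), fun p hp q _ hpq hd => ?_⟩
    obtain ⟨w, -⟩ := SimpleGraph.exists_walk_of_edist_ne_top
      (ne_top_of_le_ne_top (ENat.natCast_ne_top r) hd)
    cases w with
    | nil => exact absurd rfl hpq
    | cons hadj _ => exact absurd hadj (hno p hp _)
  · rw [← SimpleGraph.card_neighborFinset_eq_degree] at hpos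
    obtain ⟨u, hu⟩ := card_pos.1 hpos
    rw [SimpleGraph.mem_neighborFinset] at hu
    have huK := mem_componentFinset_of_adj hz hu
    have hde := hmax u huK
    have hupos : 0 < G.degree u := by
      rw [← SimpleGraph.card_neighborFinset_eq_degree]
      exact card_pos.2 ⟨z, by simpa using hu.symm⟩
    -- By maximality of `z`, degree 1 would make the edge between `u` and `z` isolated.
    have he : 2 ≤ G.degree z := by
      by_contra! hlt
      exact hG u z hu.symm ⟨by omega, by omega⟩
    have hδu : G.edist z u = 1 := SimpleGraph.edist_eq_one_iff_adj.2 hu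
    obtain ⟨c, hc⟩ := exists_isPartialColouring_sdiff (by omega) hΔ hS hS1 hk (u := u)
      (fun q => (G.edist z q).toNat)
      (fun q hq hqz => by
        have hreach : G.Reachable z q := by
          rw [← SimpleGraph.ConnectedComponent.eq, mem_componentFinset.1 hz,
            mem_componentFinset.1 hq]
        obtain ⟨n, hn⟩ := ENat.ne_top_iff_exists.1 (SimpleGraph.edist_ne_top_iff_reachable.2 hreach)
        cases n with
        | zero => exact absurd (SimpleGraph.edist_eq_zero_iff.1 hn.symm).symm hqz
        | succ n =>
          obtain ⟨t, ht, hadj⟩ := exists_mem_sphere_adj (mem_sphere.2 hn.symm)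
          refine ⟨t, mem_componentFinset_of_adj hq hadj.symm, hadj.symm, ?_⟩
          rw [mem_sphere.1 ht, ← hn, ENat.toNat_natCast, ENat.toNat_natCast]
          exact Nat.lt_succ_self n)
      hu.symm (by simp [hδu]) huK hz
    have hP : ∀ q, q ∈ componentFinset G K \ {u, z} ↔
        q ∈ componentFinset G K ∧ q ≠ u ∧ q ≠ z := fun q => by simp
    have halmost : IsAlmostColouring G r k (componentFinset G K \ {u, z}) u z c := by
      refine ⟨hc, hu.symm, by simp, by simp, ?_, ?_, ?_⟩
      · intro p hp q hadj
        have := mem_componentFinset_of_adj ((hP p).1 hp).1 hadj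
        rw [hP]
        tauto
      · intro q hadj
        have := mem_componentFinset_of_adj huK hadj
        have := hadj.ne'
        rw [hP]
        tauto
      · intro q hadj
        have := mem_componentFinset_of_adj hz hadj
        have := hadj.ne'
        rw [hP]
        tauto
    obtain ⟨c', hc'⟩ := halmost.exists_completion hr hΔ hS hΔS hk hde he
    refine ⟨c', ?_⟩
    convert hc' using 1
    ext q
    rw [mem_insert, mem_insert, hP]
    by_cases h1 : q = u
    · subst h1
      simpa using huK
    by_cases h2 : q = z
    · subst h2
      simpa using hz
    simp [h1, h2]

/-- Both ends of an edge lie in one component, so either may select the colouring to be used;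
vertices at finite distance are compared inside one component. -/
theorem exists_colouring (G : SimpleGraph V) [DecidableRel G.Adj] {r k : ℕ}
    (h : ∀ K : G.ConnectedComponent, ∃ c, IsGoodOn G r k (componentFinset G K) c) :
    ∃ c, IsProperEdgeColouring G k c ∧ DistinguishesSums G r c := by
  choose g hg using h
  let c : Sym2 V → ℕ := fun e => g (G.connectedComponentMk (Quot.out e).1) e
  have hc : ∀ p q, G.Adj p q → c s(p, q) = g (G.connectedComponentMk p) s(p, q) := by
    intro p q hadj
    have h1 := Sym2.out_fst_mem s(p, q)
    have h2 : G.connectedComponentMk (Quot.out s(p, q)).1 = G.connectedComponentMk p := by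
      rcases Sym2.mem_iff.1 h1 with h1 | h1
      · rw [h1]
      · rw [h1, SimpleGraph.ConnectedComponent.eq]
        exact hadj.symm.reachable
    simp only [c]
    rw [h2]
  have hw : ∀ p, weightedDegree G c p = weightedDegree G (g (G.connectedComponentMk p)) p :=
    fun p => weightedDegree_congr G (hc p)
  have hself : ∀ p, p ∈ componentFinset G (G.connectedComponentMk p) := fun p =>
    mem_componentFinset.2 rfl
  refine ⟨c, ⟨?_, ?_⟩, ?_⟩
  · intro e he
    induction e using Sym2.ind with
    | _ p q =>
      rw [SimpleGraph.mem_edgeSet] at he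
      rw [hc p q he]
      exact (hg _).range p (hself p) q he
  · rintro e he f hf hne ⟨v, hve, hvf⟩
    obtain ⟨a, rfl⟩ := Sym2.mem_iff_exists.1 hve
    obtain ⟨b, rfl⟩ := Sym2.mem_iff_exists.1 hvf
    rw [SimpleGraph.mem_edgeSet] at he hf
    rw [hc v a he, hc v b hf]
    exact (hg _).proper v (hself v) a b (fun hab => hne (by rw [hab])) he hf
  · intro p q hpq hd
    have hK : G.connectedComponentMk q = G.connectedComponentMk p := by
      rw [SimpleGraph.ConnectedComponent.eq]
      exact (SimpleGraph.reachable_of_edist_ne_top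
        (ne_top_of_le_ne_top (ENat.natCast_ne_top r) hd)).symm
    rw [hw p, hw q, hK]
    exact (hg _).distinct p (hself p) q (mem_componentFinset.2 hK) hpq hd

/-! ### Numerical bounds -/

theorem geom_sum_add_le (n r : ℕ) : ∑ i ∈ range (r + 4), n ^ i + n ≤ (n + 1) ^ (r + 3) := by
  induction r with
  | zero =>
    rw [show (n + 1) ^ (0 + 3) = n ^ 3 + 3 * n ^ 2 + 3 * n + 1 by ring]
    simp only [sum_range_succ, sum_range_zero, pow_zero, pow_one]
    omega
  | succ r ih =>
    have h1 : n ^ (r + 3) ≤ (n + 1) ^ (r + 3) := Nat.pow_le_pow_left (Nat.le_succ n) _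
    have h2 := Nat.mul_le_mul_left n h1
    rw [show r + 1 + 4 = r + 4 + 1 by ring, sum_range_succ, show r + 1 + 3 = r + 3 + 1 by ring,
      pow_succ (n + 1), show n ^ (r + 4) = n * n ^ (r + 3) by ring]
    nlinarith

theorem exists_sumIndex_le (G : SimpleGraph V) [DecidableRel G.Adj] {Δ r : ℕ}
    (hG : NoIsolatedEdges G) (hmax : G.maxDegree = Δ) (hΔ : 2 ≤ Δ) (hr : 2 ≤ r) :
    ∃ χ : ℕ, sumIndex G r = χ ∧ χ + 6 ≤ 6 * (∑ i ∈ range r, (Δ - 1) ^ i + Δ) := by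
  set S := ∑ i ∈ range r, (Δ - 1) ^ i with hS
  have hΔS : Δ ≤ S := by
    have h1 : ∑ i ∈ range 2, (Δ - 1) ^ i ≤ S :=
      sum_le_sum_of_subset (range_subset_range.2 hr)
    simp only [sum_range_succ, sum_range_zero, pow_zero, pow_one] at h1
    omega
  have hdeg : ∀ v, G.degree v ≤ Δ := fun v => hmax ▸ G.degree_le_maxDegree v
  obtain ⟨c, hc⟩ := exists_colouring G (r := r) (k := 3 * (2 * S + 2 * Δ - 2)) fun K =>
    exists_isGoodOn_componentFinset G hr hG hdeg (card_punctured_le G hdeg r) (by omega) hΔS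
      (by omega) K
  have hle : sumIndex G r ≤ ((3 * (2 * S + 2 * Δ - 2) : ℕ) : ℕ∞) := iInf₂_le _ ⟨c, hc⟩
  obtain ⟨χ, hχ⟩ := ENat.ne_top_iff_exists.1 (ne_top_of_le_ne_top (ENat.natCast_ne_top _) hle)
  refine ⟨χ, hχ.symm, ?_⟩
  rw [← hχ] at hle
  have := Nat.cast_le.1 hle
  omega

end DistantSum

theorem theorem1 {V : Type*} [Fintype V] [DecidableEq V] (G : SimpleGraph V) [DecidableRel G.Adj]
    (Δ r : ℕ) (hG : DistantSum.NoIsolatedEdges G) (hmax : G.maxDegree = Δ) (hΔ : 2 ≤ Δ)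
    (hr : 2 ≤ r) :
    ∃ χ : ℕ, DistantSum.sumIndex G r = (χ : ℕ∞) ∧
      (χ : ℝ) ≤ 6 * (((DistantSum.mooreBound Δ r : ℝ) - 1) / (Δ : ℝ) + (Δ : ℝ) - 1) + (Δ : ℝ) ∧
      (4 ≤ r → (χ : ℝ) ≤ 6 * (Δ : ℝ) ^ (r - 1)) ∧
      (r = 3 → (χ : ℝ) ≤ 6 * (Δ : ℝ) ^ 2 + (Δ : ℝ)) ∧
      (r = 2 → (χ : ℝ) ≤ 13 * (Δ : ℝ) - 6) := by
  obtain ⟨χ, hχ, hle⟩ := DistantSum.exists_sumIndex_le G hG hmax hΔ hr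
  obtain ⟨n, rfl⟩ : ∃ n, Δ = n + 1 := ⟨Δ - 1, by omega⟩
  rw [Nat.add_sub_cancel] at hle
  refine ⟨χ, hχ, ?_, ?_, ?_, ?_⟩
  · have h1 : ((DistantSum.mooreBound (n + 1) r : ℝ) - 1) / ((n + 1 : ℕ) : ℝ) =
        ((∑ i ∈ Finset.range r, n ^ i : ℕ) : ℝ) := by
      rw [DistantSum.mooreBound, Nat.add_sub_cancel, ← Finset.mul_sum]
      push_cast
      field_simp
      ring
    rw [h1]
    have h2 : ((χ + 6 : ℕ) : ℝ) ≤ ((6 * (∑ i ∈ Finset.range r, n ^ i + (n + 1)) : ℕ) : ℝ) :=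
      Nat.cast_le.2 hle
    push_cast at h2 ⊢
    nlinarith
  -- With n = Δ - 1 the bound 6(S + n) is at most 6(n + 1)^(r - 1) once r ≥ 4.
  · intro h4
    obtain ⟨m, rfl⟩ : ∃ m, r = m + 4 := ⟨r - 4, by omega⟩
    have h1 := DistantSum.geom_sum_add_le n m
    have h2 : χ ≤ 6 * (n + 1) ^ (m + 3) := by omega
    exact_mod_cast h2
  -- Here S + n = (n + 1)^2, so even 6Δ^2 is attained; for r = 2 below, S = Δ gives 12Δ - 6.
  · rintro rfl
    simp only [Finset.sum_range_succ, Finset.sum_range_zero] at hle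
    have h2 : χ ≤ 6 * (n + 1) ^ 2 + (n + 1) := by nlinarith
    exact_mod_cast h2
  · rintro rfl
    simp only [Finset.sum_range_succ, Finset.sum_range_zero] at hle
    have h2 : χ + 6 ≤ 13 * (n + 1) := by nlinarith
    have h3 : ((χ + 6 : ℕ) : ℝ) ≤ ((13 * (n + 1) : ℕ) : ℝ) := Nat.cast_le.2 h2
    push_cast at h3 ⊢
    linarith
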